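/- Let $\nu>0$, $\Omega=(0,1)$, and $H:[0,1]\times\mathbb R\to\mathbb R$, $H(x,p)=\sup_{\alpha\in[-1,1]}x\alpha p=x|p|$. Let $F\equiv 0:L^2(\Omega)\to H^{-1}(\Omega)$ and $G\equiv 1\in L^2(\Omega)\subset H^{-1}(\Omega)$. A pair $(u,m)\in H^1_0(\Omega)^2$ is a *PDI solution* if there is $b\in L^\infty(\Omega)$ with $b(x)\in\partial_pH(x,u'(x))$ for a.e. $x\in\Omega$ (the convex subdifferential in $p$) such that, for all $\psi,\phi\in H^1_0(\Omega)$, $$\int_\Omega \nu u'\psi'+H(x,u')\psi\,dx=\langle F[m],\psi\rangle,\qquad \int_\Omega \nu m'\phi'+m\,b\,\phi'\,dx=\langle G,\phi\rangle .$$ For a function $K:[0,1]\times\mathbb R\to\mathbb R$ that is differentiable in $p$, a *solution of the problem with Hamiltonian $K$* is a pair $(u,m)\in H^1_0(\Omega)^2$ such that, for all $\psi,\phi\in H^1_0(\Omega)$, $\int_\Omega \nu u'\psi'+K(x,u')\psi\,dx=\langle F[m],\psi\rangle$ and $\int_\Omega \nu m'\phi'+m\,\frac{\partial K}{\partial p}(x,u')\,\phi'\,dx=\langle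 G,\phi\rangle$. A family $(H_\lambda)_{\lambda\in(0,1]}$ of real functions on $[0,1]\times\mathbb R$ is *admissible* with constant $L$ if $H$ and every $H_\lambda$ are $L$-Lipschitz in $p$ for each $x\in[0,1]$; every $H_\lambda$ is continuous, is convex in $p$, and has a partial derivative $\partial H_\lambda/\partial p$ that exists and is continuous on $[0,1]\times\mathbb R$; and there is a continuous $\omega:[0,1]\to[0,\infty)$ with $\omega(0)=0$ and $|H_\lambda(x,p)-H(x,p)|\le\omega(\lambda)$ for all $(x,p)\in[0,1]\times\mathbb R$ and $\lambda\in(0,1]$. With the Moreau–Yosida regularization $\mathcal H_\lambda(x,p)=\inf_{q\in\mathbb R}\{H(x,q)+\frac1{2\lambda}|q-p|^2\}$, let $$H_\lambda(x,p)=\mathcal H_\lambda\bigl(x,\,p-\lambda x\cos(x/\lambda)\bigr)-\tfrac{\lambda}{2}x^2\cos^2(x/\lambda),\qquad \lambda\in(0,1],$$ and $\lambda_j=1/j$ for $j=1,2,3,\dots$. Then: 1. $(H_\lambda)_{\lambda\in(0,1]}$ is admissible with constant $L=1$, and $\frac{\partial H_{\lambda_j}}{\partial p}(x,0)=-x\cos(jx)$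 for all $x\in[0,1]$ and $j\ge1$. 2. For each $j$, the problem with Hamiltonian $H_{\lambda_j}$ has exactly one solution $(u_{\lambda_j},m_{\lambda_j})\in H^1_0(\Omega)^2$, and $u_{\lambda_j}=0$. 3. $(0,m)$ with $m(x)=\frac{x(1-x)}{2\nu}$ is a PDI solution, and $m\ne0$ in $H^1_0(\Omega)$. 4. $m_{\lambda_j}\rightharpoonup m$ weakly in $H^1_0(\Omega)$ as $j\to\infty$, but the limit $\lim_{j\to\infty}\|m_{\lambda_j}-m\|_{H^1(\Omega)}$ exists and is strictly positive. -/

import Mathlib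

open MeasureTheory Set Filter Topology
open scoped ENNReal ContDiff

noncomputable section

namespace MFG

/-- The real Lebesgue space `L²(Ω)`, for `Ω ⊆ ℝ`. -/
abbrev L2 (Ω : Set ℝ) : Type := Lp ℝ 2 (volume.restrict Ω)

/-- The Hilbert space `L²(Ω) × L²(Ω)` with norm `(‖f‖² + ‖g‖²)^(1/2)`. A Sobolev function `u` is
represented in it by the pair `(u, u')` of `u` and its weak derivative, so that the norm of the
pair is the `H¹`-norm of `u`. -/
abbrev L2Pair (Ω : Set ℝ) : Type := WithLp 2 (L2 Ω × L2 Ω)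

/-- `φ ∈ C_c^∞(Ω)`. -/
def IsTest (Ω : Set ℝ) (φ : ℝ → ℝ) : Prop :=
  ContDiff ℝ ∞ φ ∧ HasCompactSupport φ ∧ tsupport φ ⊆ Ω

/-- `H¹(Ω)`: the pairs `(f, g)` of `L²` functions such that `g` is the weak derivative of `f`. -/
def H1Set (Ω : Set ℝ) : Set (L2Pair Ω) :=
  {w | ∀ φ : ℝ → ℝ, IsTest Ω φ →
    ∫ x in Ω, w.fst x * deriv φ x = - ∫ x in Ω, w.snd x * φ x}

/-- The image of `C_c^∞(Ω)` in `H¹(Ω)`: the pairs `(φ, φ')`. -/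
def testPairs (Ω : Set ℝ) : Submodule ℝ (L2Pair Ω) where
  carrier := {w | ∃ φ : ℝ → ℝ, IsTest Ω φ ∧
    (∀ᵐ x ∂volume.restrict Ω, w.fst x = φ x) ∧
    (∀ᵐ x ∂volume.restrict Ω, w.snd x = deriv φ x)}
  zero_mem' := by
    refine ⟨0, ⟨contDiff_zero_fun, HasCompactSupport.zero, by simp [tsupport]⟩, ?_, ?_⟩
    · filter_upwards [Lp.coeFn_zero ℝ 2 (volume.restrict Ω)] with x hx
      simpa using hx
    · filter_upwards [Lp.coeFn_zero ℝ 2 (volume.restrict Ω)] with x hx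
      simpa using hx
  add_mem' := by
    rintro v w ⟨φ, ⟨hφ, hφc, hφs⟩, hv1, hv2⟩ ⟨χ, ⟨hχ, hχc, hχs⟩, hw1, hw2⟩
    refine ⟨φ + χ, ⟨hφ.add hχ, hφc.add hχc,
      (tsupport_add φ χ).trans (union_subset hφs hχs)⟩, ?_, ?_⟩
    · filter_upwards [hv1, hw1, Lp.coeFn_add v.fst w.fst] with x h1 h2 h3
      simpa [h1, h2] using h3
    · filter_upwards [hv2, hw2, Lp.coeFn_add v.snd w.snd] with x h1 h2 h3
      have hd : deriv (φ + χ) x = deriv φ x + deriv χ x :=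
        deriv_add (hφ.differentiable (by simp) x) (hχ.differentiable (by simp) x)
      rw [hd]
      simpa [h1, h2] using h3
  smul_mem' := by
    rintro c w ⟨φ, ⟨hφ, hφc, hφs⟩, hw1, hw2⟩
    refine ⟨fun x => c * φ x, ⟨contDiff_const.mul hφ, hφc.mul_left,
      (closure_mono fun x hx => right_ne_zero_of_mul hx).trans hφs⟩, ?_, ?_⟩
    · filter_upwards [hw1, Lp.coeFn_smul c w.fst] with x h1 h3
      simpa [h1] using h3
    · filter_upwards [hw2, Lp.coeFn_smul c w.snd] with x h1 h3
      rw [deriv_const_mul c (hφ.differentiable (by simp) x)]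
      simpa [h1] using h3

/-- `H¹₀(Ω)` as a subspace: the closure of `C_c^∞(Ω)` in the `H¹`-norm. It is contained in the
closed subspace `H¹(Ω)`, so it does not matter that the closure is taken in `L²(Ω) × L²(Ω)`. -/
def H10Submodule (Ω : Set ℝ) : Submodule ℝ (L2Pair Ω) := (testPairs Ω).topologicalClosure

/-- `H¹(Ω)` is closed in `L²(Ω) × L²(Ω)`. -/
theorem H1_closed (Ω : Set ℝ) : IsClosed (H1Set Ω) := by
  have : H1Set Ω = ⋂ (φ : ℝ → ℝ) (_ : IsTest Ω φ), {w : L2Pair Ω |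
    ∫ x in Ω, w.fst x * deriv φ x = - ∫ x in Ω, w.snd x * φ x} := by
    ext w; simp [H1Set]
  rw [this]
  refine isClosed_iInter fun φ => isClosed_iInter fun h => ?_
  have h0 : MemLp φ 2 (volume.restrict Ω) :=
    (h.1.continuous.memLp_of_hasCompactSupport h.2.1).restrict Ω
  have h1 : MemLp (deriv φ) 2 (volume.restrict Ω) :=
    ((h.1.continuous_deriv (by simp)).memLp_of_hasCompactSupport h.2.1.deriv).restrict Ω
  have key : ∀ (χ : ℝ → ℝ) (hχ : MemLp χ 2 (volume.restrict Ω)) (f : L2 Ω),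
      ∫ x in Ω, f x * χ x = inner ℝ hχ.toLp f := by
    intro χ hχ f
    rw [L2.inner_def]
    refine integral_congr_ae ?_
    filter_upwards [hχ.coeFn_toLp] with x hx
    simp [hx]
  simp only [key _ h0, key _ h1]
  refine isClosed_eq ?_ ?_
  · exact continuous_const.inner (WithLp.fstL 2 ℝ (L2 Ω) (L2 Ω)).continuous
  · exact (continuous_const.inner (WithLp.sndL 2 ℝ (L2 Ω) (L2 Ω)).continuous).neg

/-- The second component of an element of `H¹₀(Ω)` is the weak derivative of the first. -/
theorem H10_subset_H1 (Ω : Set ℝ) : (H10Submodule Ω : Set (L2Pair Ω)) ⊆ H1Set Ω := by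
  refine closure_minimal ?_ (H1_closed Ω)
  rintro w ⟨χ, hχ, hw1, hw2⟩ φ hφ
  have e1 : ∫ x in Ω, w.fst x * deriv φ x = ∫ x in Ω, χ x * deriv φ x :=
    integral_congr_ae (by filter_upwards [hw1] with x hx; rw [hx])
  have e2 : ∫ x in Ω, w.snd x * φ x = ∫ x in Ω, deriv χ x * φ x :=
    integral_congr_ae (by filter_upwards [hw2] with x hx; rw [hx])
  have z : ∀ x ∉ Ω, χ x = 0 := fun x hx => image_eq_zero_of_notMem_tsupport fun h => hx (hχ.2.2 h)
  have z' : ∀ x ∉ Ω, φ x = 0 := fun x hx => image_eq_zero_of_notMem_tsupport fun h => hx (hφ.2.2 h)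
  rw [e1, e2, setIntegral_eq_integral_of_forall_compl_eq_zero (fun x hx => by simp [z x hx]),
    setIntegral_eq_integral_of_forall_compl_eq_zero (fun x hx => by simp [z' x hx])]
  have c1 := hχ.1.continuous
  have c2 := hφ.1.continuous
  have c3 := hχ.1.continuous_deriv (by simp)
  have c4 := hφ.1.continuous_deriv (by simp)
  refine integral_mul_deriv_eq_deriv_mul_of_integrable
    (fun x _ => (hχ.1.differentiable (by simp) x).hasDerivAt)
    (fun x _ => (hφ.1.differentiable (by simp) x).hasDerivAt) ?_ ?_ ?_
  · exact (c1.mul c4).integrable_of_hasCompactSupport hχ.2.1.mul_right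
  · exact (c3.mul c2).integrable_of_hasCompactSupport hφ.2.1.mul_left
  · exact (c1.mul c2).integrable_of_hasCompactSupport hχ.2.1.mul_right

/-- The space `H¹₀(Ω)` with the `H¹`-norm. -/
abbrev H10 (Ω : Set ℝ) : Type := H10Submodule Ω

/-- The function underlying an element of `H¹₀(Ω)`. -/
def H10.fn {Ω : Set ℝ} (u : H10 Ω) : L2 Ω := (u : L2Pair Ω).fst

/-- The weak derivative of an element of `H¹₀(Ω)`. -/
def H10.grad {Ω : Set ℝ} (u : H10 Ω) : L2 Ω := (u : L2Pair Ω).snd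

/-- `H⁻¹(Ω)`, the dual of `H¹₀(Ω)`. -/
abbrev HNeg1 (Ω : Set ℝ) : Type := StrongDual ℝ (H10 Ω)

/-- The embedding `L²(Ω) ⊂ H⁻¹(Ω)`, where `g` acts by `φ ↦ ∫_Ω g φ`. -/
def HNeg1.ofL2 {Ω : Set ℝ} (g : L2 Ω) : HNeg1 Ω :=
  (innerSL ℝ g).comp ((WithLp.fstL 2 ℝ (L2 Ω) (L2 Ω)).comp (H10Submodule Ω).subtypeL)

/-- The subdifferential at `p` of a function `h` on `ℝ`. -/
def subdiff (h : ℝ → ℝ) (p : ℝ) : Set ℝ := {b | ∀ q : ℝ, h q ≥ h p + b * (q - p)}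

/-- `D_pH[v]`: the elements `b` of `L^∞(Ω)` with `b(x) ∈ ∂_p H(x, v'(x))` for a.e. `x ∈ Ω`. -/
def DpH {Ω : Set ℝ} (H : ℝ → ℝ → ℝ) (v : H10 Ω) : Set (Lp ℝ ∞ (volume.restrict Ω)) :=
  {b | ∀ᵐ x ∂volume.restrict Ω, b x ∈ subdiff (H x) (v.grad x)}

/-- `(u, m)` is a weak solution of the mean field game partial differential inclusion with
diffusion `ν`, Hamiltonian `H`, coupling `F : L²(Ω) → H⁻¹(Ω)` and source `G ∈ H⁻¹(Ω)`. -/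
def IsPDISolution {Ω : Set ℝ} (ν : ℝ) (H : ℝ → ℝ → ℝ) (F : L2 Ω → HNeg1 Ω) (G : HNeg1 Ω)
    (u m : H10 Ω) : Prop :=
  ∃ b ∈ DpH H u,
    (∀ ψ : H10 Ω,
      ∫ x in Ω, (ν * u.grad x * ψ.grad x + H x (u.grad x) * ψ.fn x) = F m.fn ψ) ∧
    (∀ φ : H10 Ω,
      ∫ x in Ω, (ν * m.grad x * φ.grad x + m.fn x * b x * φ.grad x) = G φ)

/-- `(u, m)` is a weak solution of the mean field game system of partial differential equations
with diffusion `ν`, Hamiltonian `H` differentiable in `p`, coupling `F` and source `G`. -/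
def IsPDESolution {Ω : Set ℝ} (ν : ℝ) (H : ℝ → ℝ → ℝ) (F : L2 Ω → HNeg1 Ω) (G : HNeg1 Ω)
    (u m : H10 Ω) : Prop :=
  (∀ ψ : H10 Ω,
    ∫ x in Ω, (ν * u.grad x * ψ.grad x + H x (u.grad x) * ψ.fn x) = F m.fn ψ) ∧
  (∀ φ : H10 Ω,
    ∫ x in Ω, (ν * m.grad x * φ.grad x + m.fn x * deriv (H x) (u.grad x) * φ.grad x) = G φ)

/-- The admissibility hypotheses on a family `(H_λ)`, `λ ∈ (0,1]`, of regularizations of a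
Hamiltonian `H` on `closure Ω × ℝ`, with the common Lipschitz constant `L` of `H` and all
`H_λ`. -/
structure IsRegFamily (Ω : Set ℝ) (H : ℝ → ℝ → ℝ) (L : ℝ) (Hreg : ℝ → ℝ → ℝ → ℝ) : Prop where
  lipschitz : ∀ x ∈ closure Ω, ∀ p q : ℝ, |H x p - H x q| ≤ L * |p - q|
  reg_continuous : ∀ l ∈ Ioc (0 : ℝ) 1,
    ContinuousOn (fun z : ℝ × ℝ => Hreg l z.1 z.2) (closure Ω ×ˢ univ)
  reg_lipschitz : ∀ l ∈ Ioc (0 : ℝ) 1, ∀ x ∈ closure Ω, ∀ p q : ℝ,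
    |Hreg l x p - Hreg l x q| ≤ L * |p - q|
  reg_convex : ∀ l ∈ Ioc (0 : ℝ) 1, ∀ x ∈ closure Ω, ConvexOn ℝ univ (Hreg l x)
  reg_differentiable : ∀ l ∈ Ioc (0 : ℝ) 1, ∀ x ∈ closure Ω, Differentiable ℝ (Hreg l x)
  reg_deriv_continuous : ∀ l ∈ Ioc (0 : ℝ) 1,
    ContinuousOn (fun z : ℝ × ℝ => deriv (Hreg l z.1) z.2) (closure Ω ×ˢ univ)
  approx : ∃ w : ℝ → ℝ, ContinuousOn w (Icc 0 1) ∧ (∀ l ∈ Icc (0 : ℝ) 1, 0 ≤ w l) ∧ w 0 = 0 ∧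
    ∀ l ∈ Ioc (0 : ℝ) 1, ∀ x ∈ closure Ω, ∀ p : ℝ, |Hreg l x p - H x p| ≤ w l

/-- The Moreau–Yosida regularization of `H` with respect to `p`, with parameter `l > 0`. -/
def moreauYosida (H : ℝ → ℝ → ℝ) (l x p : ℝ) : ℝ := ⨅ q : ℝ, (H x q + 1 / (2 * l) * |q - p| ^ 2)

/-- The unit interval `Ω = (0,1)`. -/
def Omega : Set ℝ := Ioo 0 1

instance : IsFiniteMeasure (volume.restrict Omega) :=
  inferInstanceAs (IsFiniteMeasure (volume.restrict (Ioo (0 : ℝ) 1)))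

/-- The Hamiltonian `H(x,p) = x|p|`. -/
def absHamiltonian (x p : ℝ) : ℝ := x * |p|

/-- The coupling `F ≡ 0` on `L²(0,1)`. -/
def zeroCoupling : L2 Omega → HNeg1 Omega := fun _ => 0

/-- The source `G ≡ 1`, as an element of `L²(0,1) ⊂ H⁻¹(0,1)`. -/
def oneSource : HNeg1 Omega := HNeg1.ofL2 (memLp_const 1).toLp

end MFG

end

/-! For `0 < l` and `0 ≤ x`, the Moreau–Yosida regularization of `x|p|` is the maximum of `a p - l
a² / 2` over `|a| ≤ x`, attained at the clamped slope `a = huberSlope l x p`. Its regularity and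
distance to `x|p|` follow from these affine minorants (`le_huber`). Shifting `p` lets the slope at
`p = 0` be any number in `[-x, x]`; the choice `-x cos (x / l)` oscillates faster and faster as `l →
0`, and the subtracted constant makes the value at `p = 0` vanish.

Hence `u = 0` solves the Hamilton–Jacobi equation. It is the only solution, because `|H_l(x, p)| ≤
|p|` and Gronwall's inequality can be started at a zero of `u'`, which Rolle's theorem provides
(`eq_zero_of_hamiltonJacobi`). What remains is a linear Fokker–Planck equation with drift `b = -x
cos (n x)`, `n = 1 / l`. Integrated once, it reads `ν m' + b m + x = c`, and the integrating factor
`exp B` with `B' = b / ν` gives its unique solution `density ν B` (`fokkerPlanck_iff`).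

The drift does not tend to zero in norm, but its potential `B` is `O(1/n)`. Therefore the densities
converge to `M = x (1 - x) / (2 ν)`, while `m_n' - M' = M x cos (n x) / ν + o(1)` in `L²`
(`tendsto_norm_sub_oscPart`). The cosine term tends weakly to zero by the Riemann–Lebesgue lemma,
yet its squared norm tends to `½ ∫ (M x / ν)² > 0`, since `cos²` has mean `1/2`. -/

namespace MFG

/-! ### Closed form of the Moreau–Yosida regularization of `x|p|` -/

/-- The derivative `clamp(p / l, -x, x)` of the Moreau–Yosida regularization of `x|p|`. -/
noncomputable def huberSlope (l x p : ℝ) : ℝ := max (-x) (min x (p / l))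

/-- The closed form of the Moreau–Yosida regularization of `x|p|`. -/
noncomputable def huber (l x p : ℝ) : ℝ := huberSlope l x p * p - l * huberSlope l x p ^ 2 / 2

theorem closure_Omega : closure Omega = Icc 0 1 := closure_Ioo (by norm_num)

theorem abs_huberSlope_le {x : ℝ} (hx : 0 ≤ x) (l p : ℝ) : |huberSlope l x p| ≤ x := by
  rw [abs_le]
  exact ⟨le_max_left _ _, max_le (by linarith) (min_le_left _ _)⟩

theorem huberSlope_eq_of_abs_le {l x a : ℝ} (hl : 0 < l) (ha : |a| ≤ x) :
    huberSlope l x (l * a) = a := by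
  rw [abs_le] at ha
  rw [huberSlope, mul_div_cancel_left₀ _ hl.ne', min_eq_right ha.2, max_eq_right ha.1]

/-- Concave duality: the clamp of `p / l` to `[-x, x]` maximizes `a ↦ a p - l a² / 2` there. In each
regime the gap is a square plus a nonnegative product. -/
theorem le_huber {l x a : ℝ} (hl : 0 < l) (ha : |a| ≤ x) (p : ℝ) :
    a * p - l * a ^ 2 / 2 ≤ huber l x p := by
  have hp : l * (p / l) = p := mul_div_cancel₀ p hl.ne'
  rw [abs_le] at ha
  obtain ⟨r, hr⟩ : ∃ r, r = p / l := ⟨_, rfl⟩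
  rw [huber, huberSlope, ← hr]
  rw [← hr] at hp
  subst hp
  rcases le_total x r with h | h
  · rw [min_eq_left h, max_eq_right (by linarith)]
    nlinarith [mul_nonneg hl.le (mul_nonneg (sub_nonneg.2 ha.2) (sub_nonneg.2 h)),
      mul_nonneg hl.le (sq_nonneg (x - a))]
  · rw [min_eq_right h]
    rcases le_total (-x) r with h' | h'
    · rw [max_eq_right h']
      nlinarith [mul_nonneg hl.le (sq_nonneg (r - a))]
    · rw [max_eq_left h']
      nlinarith [mul_nonneg hl.le (mul_nonneg (sub_nonneg.2 ha.1) (sub_nonneg.2 h')),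
        mul_nonneg hl.le (sq_nonneg (x + a))]

/-- The minorant of `le_huber` with `a` the slope at `p` touches the graph at `p`, so the slope is a
subgradient. -/
theorem huber_supporting {l x : ℝ} (hl : 0 < l) (hx : 0 ≤ x) (p q : ℝ) :
    huber l x p + huberSlope l x p * (q - p) ≤ huber l x q := by
  have := le_huber hl (abs_huberSlope_le hx l p) q
  rw [huber]
  linarith

theorem huber_sub_le {l x : ℝ} (hl : 0 < l) (hx : 0 ≤ x) (p q : ℝ) :
    huber l x q - huber l x p ≤ huberSlope l x q * (q - p) := by
  have := huber_supporting hl hx q p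
  linarith

theorem abs_huber_sub_le {l x : ℝ} (hl : 0 < l) (hx : 0 ≤ x) (p q : ℝ) :
    |huber l x p - huber l x q| ≤ x * |p - q| := by
  have key : ∀ p q : ℝ, huber l x p - huber l x q ≤ x * |p - q| := fun p q =>
    (huber_sub_le hl hx q p).trans ((le_abs_self _).trans (by
      rw [abs_mul]
      exact mul_le_mul_of_nonneg_right (abs_huberSlope_le hx l p) (abs_nonneg _)))
  rw [abs_le]
  constructor
  · have := key q p
    rw [abs_sub_comm] at this
    linarith
  · exact key p q

theorem continuous_huberSlope (l : ℝ) : Continuous fun z : ℝ × ℝ => huberSlope l z.1 z.2 := by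
  unfold huberSlope
  fun_prop

theorem continuous_huber (l : ℝ) : Continuous fun z : ℝ × ℝ => huber l z.1 z.2 := by
  unfold huber
  have := continuous_huberSlope l
  fun_prop

/-- A continuous selection of subgradients is the derivative: the first-order error lies between `0`
and the increment of the slope times `q - p`. -/
theorem hasDerivAt_huber {l x : ℝ} (hl : 0 < l) (hx : 0 ≤ x) (p : ℝ) :
    HasDerivAt (huber l x) (huberSlope l x p) p := by
  rw [hasDerivAt_iff_isLittleO, Asymptotics.isLittleO_iff]
  intro c hc
  have hs : Continuous (huberSlope l x) := (continuous_huberSlope l).comp (by fun_prop :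
    Continuous fun q : ℝ => (x, q))
  filter_upwards [Metric.tendsto_nhds.1 hs.continuousAt c hc] with q hq
  have h1 := huber_supporting hl hx p q
  have h2 := huber_sub_le hl hx p q
  rw [Real.dist_eq] at hq
  rw [Real.norm_eq_abs, Real.norm_eq_abs, smul_eq_mul, abs_of_nonneg (by linarith)]
  calc _ ≤ (huberSlope l x q - huberSlope l x p) * (q - p) := by linarith
    _ ≤ |(huberSlope l x q - huberSlope l x p) * (q - p)| := le_abs_self _
    _ ≤ _ := by
      rw [abs_mul]
      exact mul_le_mul_of_nonneg_right hq.le (abs_nonneg _)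

/-- Completing the square in `q` bounds the infimum from below; the proximal point `q = p - l *
huberSlope l x p` attains it. -/
theorem moreauYosida_absHamiltonian {l x : ℝ} (hl : 0 < l) (hx : 0 ≤ x) (p : ℝ) :
    moreauYosida absHamiltonian l x p = huber l x p := by
  have hp : l * (p / l) = p := mul_div_cancel₀ p hl.ne'
  have hlow : ∀ q : ℝ, huber l x p ≤ absHamiltonian x q + 1 / (2 * l) * |q - p| ^ 2 := by
    intro q
    have hs := abs_huberSlope_le hx l p
    have h1 : huberSlope l x p * q ≤ x * |q| := (le_abs_self _).trans (by
      rw [abs_mul]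
      exact mul_le_mul_of_nonneg_right hs (abs_nonneg _))
    have h2 : huberSlope l x p * q + 1 / (2 * l) * |q - p| ^ 2 - huber l x p
        = (q - p + l * huberSlope l x p) ^ 2 / (2 * l) := by
      rw [sq_abs, huber]
      field_simp
      ring
    have h3 : 0 ≤ (q - p + l * huberSlope l x p) ^ 2 / (2 * l) := by positivity
    rw [absHamiltonian]
    linarith
  refine le_antisymm ?_ (le_ciInf hlow)
  refine (ciInf_le ⟨huber l x p, by rintro _ ⟨q, rfl⟩; exact hlow q⟩
    (p - l * huberSlope l x p)).trans (le_of_eq ?_)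
  -- At the proximal point `q`, either `q = 0` or the slope is saturated at `±x` with the sign of
  -- `q`.
  have hkey : x * |p - l * huberSlope l x p|
      = huberSlope l x p * (p - l * huberSlope l x p) := by
    obtain ⟨r, hr⟩ : ∃ r, r = p / l := ⟨_, rfl⟩
    rw [← hr] at hp
    rw [huberSlope, ← hr]
    subst hp
    rcases le_total x r with h | h
    · rw [min_eq_left h, max_eq_right (by linarith), abs_of_nonneg]
      nlinarith
    · rw [min_eq_right h]
      rcases le_total (-x) r with h' | h'
      · rw [max_eq_right h']
        simp
      · rw [max_eq_left h', abs_of_nonpos (by nlinarith)]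
        ring
  simp only [absHamiltonian, hkey, sq_abs]
  rw [huber]
  field_simp
  ring

theorem huber_le_absHamiltonian {l x : ℝ} (hl : 0 < l) (hx : 0 ≤ x) (p : ℝ) :
    huber l x p ≤ absHamiltonian x p := by
  have h1 := abs_huberSlope_le hx l p
  have h2 : huberSlope l x p * p ≤ x * |p| := (le_abs_self _).trans (by
    rw [abs_mul]
    exact mul_le_mul_of_nonneg_right h1 (abs_nonneg _))
  rw [huber, absHamiltonian]
  nlinarith [mul_nonneg hl.le (sq_nonneg (huberSlope l x p))]

/-- The extreme minorants `a = x` and `a = -x` already give `x|p|` up to `l x² / 2`. -/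
theorem absHamiltonian_le_huber_add {l x : ℝ} (hl : 0 < l) (hx : 0 ≤ x) (p : ℝ) :
    absHamiltonian x p ≤ huber l x p + l * x ^ 2 / 2 := by
  rw [absHamiltonian]
  rcases le_total 0 p with h | h
  · have := le_huber hl (abs_of_nonneg hx).le p
    rw [abs_of_nonneg h]
    linarith
  · have := le_huber (a := -x) hl (by rw [abs_neg, abs_of_nonneg hx]) p
    rw [abs_of_nonpos h]
    linarith

theorem isLUB_absHamiltonian {x : ℝ} (hx : 0 ≤ x) (p : ℝ) :
    IsLUB ((fun α : ℝ => x * α * p) '' Icc (-1) 1) (absHamiltonian x p) := by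
  constructor
  · rintro _ ⟨a, ha, rfl⟩
    have : a * p ≤ |p| := (le_abs_self _).trans (by
      rw [abs_mul]
      exact mul_le_of_le_one_left (abs_nonneg _) (abs_le.2 ha))
    simpa [absHamiltonian, mul_assoc] using mul_le_mul_of_nonneg_left this hx
  · intro c hc
    rw [absHamiltonian]
    rcases le_total 0 p with h | h
    · rw [abs_of_nonneg h]
      exact hc ⟨1, by norm_num, by ring⟩
    · rw [abs_of_nonpos h]
      exact hc ⟨-1, by norm_num, by ring⟩

/-! ### The shifted regularization and its admissibility -/

/-- The shifted Huber regularization of `x|p|`, with slope `-x cos (x / l)` at `p = 0`. -/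
noncomputable def shiftedHuber (l x p : ℝ) : ℝ :=
  huber l x (p - l * x * Real.cos (x / l)) - l * x ^ 2 * Real.cos (x / l) ^ 2 / 2

theorem continuous_shiftedHuber (l : ℝ) :
    Continuous fun z : ℝ × ℝ => shiftedHuber l z.1 z.2 := by
  unfold shiftedHuber
  refine ((continuous_huber l).comp (by fun_prop :
    Continuous fun z : ℝ × ℝ => (z.1, z.2 - l * z.1 * Real.cos (z.1 / l)))).sub ?_
  fun_prop

theorem hasDerivAt_shiftedHuber {l x : ℝ} (hl : 0 < l) (hx : 0 ≤ x) (p : ℝ) :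
    HasDerivAt (shiftedHuber l x) (huberSlope l x (p - l * x * Real.cos (x / l))) p := by
  unfold shiftedHuber
  simpa using ((hasDerivAt_huber hl hx (p - l * x * Real.cos (x / l))).comp p
    ((hasDerivAt_id p).sub_const _)).sub_const (l * x ^ 2 * Real.cos (x / l) ^ 2 / 2)

/-- The shift is `l` times a number in `[-x, x]`, so the clamp does not act. -/
theorem huberSlope_shift {l x : ℝ} (hl : 0 < l) (hx : 0 ≤ x) :
    huberSlope l x (0 - l * x * Real.cos (x / l)) = -x * Real.cos (x / l) := by
  rw [← huberSlope_eq_of_abs_le (a := -x * Real.cos (x / l)) hl]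
  · congr 1
    ring
  · rw [abs_mul, abs_neg, abs_of_nonneg hx]
    exact mul_le_of_le_one_right hx (Real.abs_cos_le_one _)

theorem shiftedHuber_zero {l x : ℝ} (hl : 0 < l) (hx : 0 ≤ x) : shiftedHuber l x 0 = 0 := by
  rw [shiftedHuber, huber, huberSlope_shift hl hx]
  ring

theorem abs_shiftedHuber_sub_le {l x : ℝ} (hl : 0 < l) (hx : 0 ≤ x) (p q : ℝ) :
    |shiftedHuber l x p - shiftedHuber l x q| ≤ x * |p - q| := by
  have := abs_huber_sub_le hl hx (p - l * x * Real.cos (x / l)) (q - l * x * Real.cos (x / l))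
  simpa [shiftedHuber] using this

/-- Three errors add up to at most `2 l`: `l / 2` from the regularization, `l` from shifting `p` in
`x|p|`, and `l / 2` from the subtracted constant. -/
theorem abs_shiftedHuber_sub_absHamiltonian_le {l x : ℝ} (hl : 0 < l) (hx : x ∈ Icc (0 : ℝ) 1)
    (p : ℝ) : |shiftedHuber l x p - absHamiltonian x p| ≤ 2 * l := by
  obtain ⟨hx0, hx1⟩ := hx
  set c := Real.cos (x / l) with hc
  have hc1 : |c| ≤ 1 := Real.abs_cos_le_one _
  have hc2 : c ^ 2 ≤ 1 := (sq_le_one_iff_abs_le_one c).2 hc1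
  have hxx : x ^ 2 ≤ 1 := pow_le_one₀ hx0 hx1
  have hlx : l * x ^ 2 ≤ l := mul_le_of_le_one_right hl.le hxx
  have h1 := huber_le_absHamiltonian hl hx0 (p - l * x * c)
  have h2 := absHamiltonian_le_huber_add hl hx0 (p - l * x * c)
  have h3 : |absHamiltonian x (p - l * x * c) - absHamiltonian x p| ≤ l := by
    rw [absHamiltonian, absHamiltonian, ← mul_sub, abs_mul, abs_of_nonneg hx0]
    calc x * |(|p - l * x * c| - |p|)| ≤ x * |l * x * c| := by
          refine mul_le_mul_of_nonneg_left ?_ hx0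
          refine (abs_abs_sub_abs_le_abs_sub _ _).trans (le_of_eq ?_)
          rw [← abs_neg]
          congr 1
          ring
      _ = l * x ^ 2 * |c| := by
          rw [abs_mul, abs_mul, abs_of_pos hl, abs_of_nonneg hx0]
          ring
      _ ≤ l * x ^ 2 := mul_le_of_le_one_right (by positivity) hc1
      _ ≤ l := hlx
  have h4 : 0 ≤ l * x ^ 2 * c ^ 2 := by positivity
  have h5 : l * x ^ 2 * c ^ 2 ≤ l := (mul_le_of_le_one_right (by positivity) hc2).trans hlx
  rw [abs_le] at h3
  rw [shiftedHuber, ← hc, abs_le]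
  constructor <;> linarith

theorem convexOn_shiftedHuber {l x : ℝ} (hl : 0 < l) (hx : 0 ≤ x) :
    ConvexOn ℝ univ (shiftedHuber l x) := by
  refine ⟨convex_univ, fun p _ q _ a b ha hb hab => ?_⟩
  set d := l * x * Real.cos (x / l)
  set r := a * p + b * q - d with hr
  have h1 := mul_le_mul_of_nonneg_left (huber_supporting hl hx r (p - d)) ha
  have h2 := mul_le_mul_of_nonneg_left (huber_supporting hl hx r (q - d)) hb
  simp only [shiftedHuber, smul_eq_mul]
  rw [← hr]
  obtain rfl : b = 1 - a := by linarith
  -- Both points use the supporting line at their weighted mean `r`, so the linear terms cancel.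
  have h3 : a * (huberSlope l x r * (p - d - r)) + (1 - a) * (huberSlope l x r * (q - d - r))
      = 0 := by
    rw [hr]
    ring
  nlinarith

theorem isRegFamily_shiftedHuber :
    IsRegFamily Omega absHamiltonian 1 shiftedHuber := by
  have hlip : ∀ x ∈ Icc (0 : ℝ) 1, ∀ t s : ℝ, t ≤ x * |s| → t ≤ 1 * |s| := fun x hx t s h =>
    h.trans (mul_le_mul_of_nonneg_right hx.2 (abs_nonneg _))
  constructor <;> rw [closure_Omega]
  · intro x hx p q
    refine hlip x hx _ _ ?_
    rw [absHamiltonian, absHamiltonian, ← mul_sub, abs_mul, abs_of_nonneg hx.1]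
    exact mul_le_mul_of_nonneg_left (abs_abs_sub_abs_le_abs_sub _ _) hx.1
  · exact fun l _ => (continuous_shiftedHuber l).continuousOn
  · exact fun l hl x hx p q => hlip x hx _ _ (abs_shiftedHuber_sub_le hl.1 hx.1 p q)
  · exact fun l hl x hx => convexOn_shiftedHuber hl.1 hx.1
  · exact fun l hl x hx p => (hasDerivAt_shiftedHuber hl.1 hx.1 p).differentiableAt
  · intro l hl
    refine ContinuousOn.congr (f := fun z : ℝ × ℝ =>
      huberSlope l z.1 (z.2 - l * z.1 * Real.cos (z.1 / l))) ?_ ?_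
    · exact ((continuous_huberSlope l).comp (by fun_prop : Continuous fun z : ℝ × ℝ =>
        (z.1, z.2 - l * z.1 * Real.cos (z.1 / l)))).continuousOn
    · rintro ⟨x, p⟩ ⟨hx, -⟩
      exact (hasDerivAt_shiftedHuber hl.1 hx.1 p).deriv
  · exact ⟨fun l => 2 * l, by fun_prop, fun l hl => by linarith [hl.1], by simp,
      fun l hl x hx p => abs_shiftedHuber_sub_absHamiltonian_le hl.1 hx p⟩

/-! ### Primitives and integration by parts on `(0,1)` -/

/-- The primitive of `g` vanishing at `0`. -/
noncomputable def prim (g : ℝ → ℝ) (x : ℝ) : ℝ := ∫ t in (0 : ℝ)..x, g t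

theorem measurableSet_Omega : MeasurableSet Omega := measurableSet_Ioo

theorem setIntegral_Omega (g : ℝ → ℝ) : ∫ x in Omega, g x = ∫ x in (0 : ℝ)..1, g x := by
  rw [intervalIntegral.integral_of_le zero_le_one, integral_Ioc_eq_integral_Ioo, Omega]

theorem integrable_Omega_iff (g : ℝ → ℝ) :
    Integrable g (volume.restrict Omega) ↔ IntervalIntegrable g volume 0 1 := by
  rw [intervalIntegrable_iff_integrableOn_Ioo_of_le zero_le_one, IntegrableOn, Omega]

theorem ae_Omega {p : ℝ → Prop} (h : ∀ x ∈ Icc (0 : ℝ) 1, p x) :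
    ∀ᵐ x ∂volume.restrict Omega, p x :=
  (ae_restrict_iff' measurableSet_Omega).2 (Eventually.of_forall fun x hx =>
    h x (Ioo_subset_Icc_self hx))

theorem intervalIntegral_congr_ae_Omega {f g : ℝ → ℝ} (h : f =ᵐ[volume.restrict Omega] g)
    {a b : ℝ} (ha : a ∈ Icc (0 : ℝ) 1) (hb : b ∈ Icc (0 : ℝ) 1) :
    ∫ t in a..b, f t = ∫ t in a..b, g t := by
  refine intervalIntegral.integral_congr_ae ?_
  have h1 : ∀ᵐ x ∂volume.restrict (Ioc (0 : ℝ) 1), f x = g x := by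
    rwa [← restrict_Ioo_eq_restrict_Ioc]
  filter_upwards [(ae_restrict_iff' measurableSet_Ioc).1 h1] with x hx hx'
  refine hx ?_
  rw [uIoc] at hx'
  exact ⟨(le_min ha.1 hb.1).trans_lt hx'.1, hx'.2.trans (max_le ha.2 hb.2)⟩

theorem continuousOn_prim {g : ℝ → ℝ} (hg : Integrable g (volume.restrict Omega)) :
    ContinuousOn (prim g) (Icc 0 1) := by
  have h := (integrable_Omega_iff g).1 hg
  rw [intervalIntegrable_iff_integrableOn_Icc_of_le zero_le_one] at h
  have := intervalIntegral.continuousOn_primitive_interval (μ := volume) (f := g) (a := 0) (b := 1)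
    (by rwa [uIcc_of_le zero_le_one])
  rwa [uIcc_of_le zero_le_one] at this

theorem memLp_of_continuousOn {f : ℝ → ℝ} (hf : ContinuousOn f (Icc 0 1)) (p : ℝ≥0∞) :
    MemLp f p (volume.restrict Omega) := by
  obtain ⟨C, hC⟩ := isCompact_Icc.exists_bound_of_continuousOn hf
  refine MemLp.of_bound ?_ C (ae_Omega hC)
  exact (hf.mono Ioo_subset_Icc_self).aestronglyMeasurable measurableSet_Omega

theorem memLp_prim {g : ℝ → ℝ} (hg : Integrable g (volume.restrict Omega)) (p : ℝ≥0∞) :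
    MemLp (prim g) p (volume.restrict Omega) :=
  memLp_of_continuousOn (continuousOn_prim hg) p

theorem integrable_mul_of_memLp {f g : ℝ → ℝ} (hf : MemLp f 2 (volume.restrict Omega))
    (hg : MemLp g 2 (volume.restrict Omega)) :
    Integrable (fun x => f x * g x) (volume.restrict Omega) := hf.integrable_mul hg

theorem integrable_of_memLp_two {f : ℝ → ℝ} (hf : MemLp f 2 (volume.restrict Omega)) :
    Integrable f (volume.restrict Omega) := hf.integrable one_le_two

theorem integrable_mul_prim {k g : ℝ → ℝ} (hk : Integrable k (volume.restrict Omega))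
    (hg : Integrable g (volume.restrict Omega)) :
    Integrable (fun x => k x * prim g x) (volume.restrict Omega) := by
  have := hk.mul_of_top_left (memLp_prim hg ∞)
  exact this

/-- Integration by parts for primitives of integrable functions. -/
theorem integral_mul_prim {k g : ℝ → ℝ} (hk : Integrable k (volume.restrict Omega))
    (hg : Integrable g (volume.restrict Omega)) :
    ∫ x in Omega, k x * prim g x =
      (∫ x in Omega, k x) * (∫ x in Omega, g x) - ∫ x in Omega, prim k x * g x := by
  set μ := volume.restrict Omega with hμ
  -- With the primitive written as an integral over `t ≤ x`, the claim is Fubini on the triangle `t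
  -- ≤ x`: integrating in `x` first leaves the total mass of `k` minus its primitive at `t`.
  have h1 : ∀ x ∈ Icc (0 : ℝ) 1, ∀ g : ℝ → ℝ,
      prim g x = ∫ t, (Iic x).indicator g t ∂μ := by
    intro x hx g
    rw [integral_indicator measurableSet_Iic, hμ, Measure.restrict_restrict measurableSet_Iic,
      prim, intervalIntegral.integral_of_le hx.1, ← restrict_Ioo_eq_restrict_Ioc]
    rw [restrict_Ioo_eq_restrict_Ioc]
    refine setIntegral_congr_set ?_
    have : (Iic x ∩ Ioc 0 1 : Set ℝ) = Ioc 0 x := by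
      ext t
      simp only [mem_inter_iff, mem_Iic, mem_Ioc]
      constructor
      · rintro ⟨h, h', -⟩
        exact ⟨h', h⟩
      · rintro ⟨h, h'⟩
        exact ⟨h', h, h'.trans hx.2⟩
    rw [← this]
    exact (ae_eq_refl _).inter Ioo_ae_eq_Ioc.symm
  have h2 : Integrable (Function.uncurry fun x t => k x * (Iic x).indicator g t) (μ.prod μ) := by
    have := (hk.mul_prod hg).indicator
      (measurableSet_le measurable_snd measurable_fst : MeasurableSet {z : ℝ × ℝ | z.2 ≤ z.1})
    refine this.congr (Eventually.of_forall fun z => ?_)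
    by_cases hz : z.2 ≤ z.1 <;> simp [Function.uncurry, indicator, hz]
  have h3 : ∀ᵐ t ∂μ, ∫ x, k x * (Iic x).indicator g t ∂μ
      = (∫ x, k x ∂μ) * g t - prim k t * g t := by
    refine ae_Omega fun t ht => ?_
    have h4 : (fun x => k x * (Iic x).indicator g t)
        = fun x => k x * g t - (Iio t).indicator k x * g t := by
      ext x
      rcases le_or_gt t x with h | h
      · simp [indicator, h, not_lt.2 h]
      · simp [indicator, h, not_le.2 h]
    have h5 : ∫ x, (Iio t).indicator k x ∂μ = prim k t := by
      rw [h1 t ht k, integral_indicator measurableSet_Iio, integral_indicator measurableSet_Iic]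
      refine setIntegral_congr_set ?_
      exact ae_restrict_of_ae Iio_ae_eq_Iic
    rw [h4, integral_sub (hk.mul_const _) ((hk.indicator measurableSet_Iio).mul_const _),
      integral_mul_const, integral_mul_const, h5]
  have h6 : Integrable (fun t => prim k t * g t) μ := by
    simpa only [mul_comm] using integrable_mul_prim hg hk
  calc ∫ x, k x * prim g x ∂μ = ∫ x, ∫ t, k x * (Iic x).indicator g t ∂μ ∂μ := by
        refine integral_congr_ae (ae_Omega fun x hx => ?_)
        simp only [integral_const_mul, h1 x hx g]
    _ = ∫ t, ∫ x, k x * (Iic x).indicator g t ∂μ ∂μ := integral_integral_swap h2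
    _ = ∫ t, ((∫ x, k x ∂μ) * g t - prim k t * g t) ∂μ := integral_congr_ae h3
    _ = _ := by rw [integral_sub (hg.const_mul _) h6, integral_const_mul]

theorem L2_inner_eq (f g : L2 Omega) : inner ℝ f g = ∫ x in Omega, f x * g x := by
  rw [L2.inner_def]
  refine integral_congr_ae (Eventually.of_forall fun x => ?_)
  simp [mul_comm]

theorem L2_integrable (f : L2 Omega) : Integrable f (volume.restrict Omega) :=
  integrable_of_memLp_two (Lp.memLp f)

/-! ### Test functions and the du Bois-Reymond lemma -/

theorem IsTest.prim_deriv {φ : ℝ → ℝ} (hφ : IsTest Omega φ) (x : ℝ) :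
    prim (deriv φ) x = φ x := by
  have h0 : φ 0 = 0 := image_eq_zero_of_notMem_tsupport fun h => by
    have := hφ.2.2 h
    simp [Omega] at this
  rw [prim, intervalIntegral.integral_deriv_eq_sub
    (fun x _ => hφ.1.differentiable (by simp) x)
    ((hφ.1.continuous_deriv (by simp)).intervalIntegrable _ _), h0, sub_zero]

theorem IsTest.integral_deriv {φ : ℝ → ℝ} (hφ : IsTest Omega φ) :
    ∫ x in Omega, deriv φ x = 0 := by
  have h1 : φ 1 = 0 := image_eq_zero_of_notMem_tsupport fun h => by
    have := hφ.2.2 h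
    simp [Omega] at this
  rw [setIntegral_Omega]
  exact (hφ.prim_deriv 1).trans h1

theorem IsTest.memLp {φ : ℝ → ℝ} (hφ : IsTest Omega φ) (p : ℝ≥0∞) :
    MemLp φ p (volume.restrict Omega) :=
  memLp_of_continuousOn hφ.1.continuous.continuousOn p

theorem IsTest.memLp_deriv {φ : ℝ → ℝ} (hφ : IsTest Omega φ) (p : ℝ≥0∞) :
    MemLp (deriv φ) p (volume.restrict Omega) :=
  memLp_of_continuousOn (hφ.1.continuous_deriv (by simp)).continuousOn p

/-- A test function with vanishing integral is the derivative of a test function. -/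
theorem IsTest.exists_deriv_eq {χ : ℝ → ℝ} (hχ : IsTest Omega χ)
    (h0 : ∫ x in Omega, χ x = 0) : ∃ φ, IsTest Omega φ ∧ deriv φ = χ := by
  have hd : ∀ x, HasDerivAt (prim χ) (χ x) x := fun x =>
    intervalIntegral.integral_hasDerivAt_right (hχ.1.continuous.intervalIntegrable _ _)
      (hχ.1.continuous.stronglyMeasurableAtFilter _ _) hχ.1.continuous.continuousAt
  have hderiv : deriv (prim χ) = χ := funext fun x => (hd x).deriv
  obtain ⟨a, b, hab, hsub⟩ : ∃ a b : ℝ, Icc a b ⊆ Omega ∧ tsupport χ ⊆ Icc a b := by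
    rcases (tsupport χ).eq_empty_or_nonempty with h | h
    -- For `χ = 0` an empty interval serves.
    · exact ⟨1, 0, by simp, by simp [h]⟩
    · have hc : IsCompact (tsupport χ) := hχ.2.1
      refine ⟨sInf (tsupport χ), sSup (tsupport χ), ?_, fun x hx =>
        ⟨csInf_le hc.bddBelow hx, le_csSup hc.bddAbove hx⟩⟩
      exact Icc_subset_Ioo (hχ.2.2 (hc.sInf_mem h)).1 (hχ.2.2 (hc.sSup_mem h)).2
  have hz : ∀ x, x ∉ Icc a b → prim χ x = 0 := by
    have hχz : ∀ x, x ∉ Icc a b → χ x = 0 := fun x hx =>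
      image_eq_zero_of_notMem_tsupport fun h => hx (hsub h)
    by_cases hle : a ≤ b
    · have ha : 0 < a := (hab (left_mem_Icc.2 hle)).1
      have hb : b < 1 := (hab (right_mem_Icc.2 hle)).2
      intro x hx
      rcases lt_or_ge x a with h | h
      · rw [prim, intervalIntegral.integral_congr (g := fun _ => 0)]
        · simp
        · intro t ht
          refine hχz t fun h' => ?_
          have := ht.2.trans (max_le ha.le h.le)
          rcases le_total 0 x with h0 | h0
          · rw [uIcc_of_le h0] at ht
            linarith [ht.2, h'.1]
          · rw [uIcc_of_ge h0] at ht
            linarith [ht.2, h'.1]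
      · have hbx : b < x := by
          by_contra hcon
          exact hx ⟨h, not_lt.1 hcon⟩
        rw [setIntegral_Omega] at h0
        -- To the right of the support, the primitive equals the total integral, which is zero.
        have h2 : ∫ t in x..1, χ t = 0 := by
          rw [intervalIntegral.integral_congr (g := fun _ => 0)]
          · simp
          · intro t ht
            refine hχz t fun h' => ?_
            rcases le_total x 1 with h0 | h0
            · rw [uIcc_of_le h0] at ht
              linarith [ht.1, h'.2]
            · rw [uIcc_of_ge h0] at ht
              linarith [ht.1, h'.2]
        have h3 := intervalIntegral.integral_add_adjacent_intervals
          (hχ.1.continuous.intervalIntegrable (μ := volume) 0 x)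
          (hχ.1.continuous.intervalIntegrable x 1)
        rw [prim]
        linarith
    · intro x _
      have : χ = fun _ => 0 := funext fun t => hχz t fun h => hle (h.1.trans h.2)
      simp [prim, this]
  have hts : tsupport (prim χ) ⊆ Icc a b :=
    closure_minimal (fun x hx => by_contra fun h => hx (hz x h)) isClosed_Icc
  refine ⟨prim χ, ⟨?_, ?_, hts.trans hab⟩, hderiv⟩
  · rw [contDiff_infty_iff_deriv]
    exact ⟨fun x => (hd x).differentiableAt, by rw [hderiv]; exact hχ.1⟩
  · exact isCompact_Icc.of_isClosed_subset (isClosed_tsupport _) hts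

theorem exists_isTest_integral_eq_one : ∃ η, IsTest Omega η ∧ ∫ x in Omega, η x = 1 := by
  let f : ContDiffBump (1 / 2 : ℝ) := ⟨1 / 8, 1 / 4, by norm_num, by norm_num⟩
  refine ⟨f.normed volume, ⟨f.contDiff_normed, f.hasCompactSupport_normed, ?_⟩, ?_⟩
  · rw [f.tsupport_normed_eq, Real.closedBall_eq_Icc]
    exact Icc_subset_Ioo (by norm_num [f]) (by norm_num [f])
  · rw [setIntegral_eq_integral_of_forall_compl_eq_zero, f.integral_normed]
    intro x hx
    by_contra h
    have : x ∈ Function.support (f.normed volume) := h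
    rw [f.support_normed_eq, Real.ball_eq_Ioo] at this
    exact hx ⟨by have := this.1; norm_num [f] at this; linarith,
      by have := this.2; norm_num [f] at this; linarith⟩

/-- The du Bois-Reymond lemma, tested with smooth functions. -/
theorem ae_eq_const_of_integral_mul_deriv {h : ℝ → ℝ} (hh : MemLp h 2 (volume.restrict Omega))
    (h0 : ∀ φ, IsTest Omega φ → ∫ x in Omega, h x * deriv φ x = 0) :
    ∃ c : ℝ, ∀ᵐ x ∂volume.restrict Omega, h x = c := by
  obtain ⟨η, hη, hη1⟩ := exists_isTest_integral_eq_one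
  set c := ∫ x in Omega, h x * η x with hc
  refine ⟨c, ?_⟩
  have hi : Integrable (fun x => h x - c) (volume.restrict Omega) :=
    (integrable_of_memLp_two hh).sub (integrable_const _)
  have := isOpen_Ioo.ae_eq_zero_of_integral_contDiff_smul_eq_zero (U := Omega)
    (f := fun x => h x - c) (μ := volume) ?_ ?_
  · rw [ae_restrict_iff' measurableSet_Omega]
    filter_upwards [this] with x hx hx'
    exact sub_eq_zero.1 (hx hx')
  · exact IntegrableOn.locallyIntegrableOn hi
  · intro χ h1 h2 h3
    have hχ : IsTest Omega χ := ⟨h1, h2, h3⟩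
    set d := ∫ x in Omega, χ x with hd
    have iχ := integrable_of_memLp_two (hχ.memLp 2)
    have iη := integrable_of_memLp_two (hη.memLp 2)
    -- Removing `d` copies of the unit-mass bump `η` makes the mean zero, so the difference is the
    -- derivative of a test function.
    have hT : IsTest Omega (fun x => χ x - d * η x) := by
      refine ⟨hχ.1.sub (contDiff_const.mul hη.1), hχ.2.1.sub hη.2.1.mul_left, ?_⟩
      refine (tsupport_sub _ _).trans (union_subset hχ.2.2 ?_)
      exact (closure_mono fun x hx => right_ne_zero_of_mul hx).trans hη.2.2
    obtain ⟨φ, hφ, hφd⟩ := hT.exists_deriv_eq (by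
      rw [integral_sub iχ (iη.const_mul _), integral_const_mul, hη1]
      simp [hd])
    have e := h0 φ hφ
    rw [hφd] at e
    rw [← setIntegral_eq_integral_of_forall_compl_eq_zero (s := Omega) (fun x hx => by
      rw [image_eq_zero_of_notMem_tsupport fun h => hx (h3 h), zero_smul])]
    have i1 := integrable_mul_of_memLp hh (hχ.memLp 2)
    have i2 := integrable_mul_of_memLp hh (hη.memLp 2)
    have e1 : ∫ x in Omega, h x * (χ x - d * η x)
        = (∫ x in Omega, h x * χ x) - d * c := by
      rw [hc, ← integral_const_mul, ← integral_sub i1 (i2.const_mul _)]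
      exact integral_congr_ae (Eventually.of_forall fun x => by ring)
    have e2 : ∫ x in Omega, χ x • (h x - c) = (∫ x in Omega, h x * χ x) - d * c := by
      rw [hd, ← integral_mul_const, ← integral_sub i1 (iχ.mul_const _)]
      exact integral_congr_ae (Eventually.of_forall fun x => by simp only [smul_eq_mul]; ring)
    rw [e2, ← e1, e]

/-! ### Elements of `H¹₀(0,1)` as primitives of mean-zero functions -/

theorem memLp_tail (h : L2 Omega) :
    MemLp (fun x => (∫ t in Omega, h t) - prim h x) 2 (volume.restrict Omega) :=
  (memLp_const _).sub (memLp_prim (L2_integrable h) 2)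

/-- The tail `∫_x^1 h` is the `L²`-adjoint of `prim` applied to `h`. -/
theorem integral_mul_tail (h : L2 Omega) {g : ℝ → ℝ}
    (hg : Integrable g (volume.restrict Omega)) :
    ∫ x in Omega, h x * prim g x
      = ∫ x in Omega, ((∫ t in Omega, h t) - prim h x) * g x := by
  have hi : Integrable (fun x => prim h x * g x) (volume.restrict Omega) := by
    simpa only [mul_comm] using integrable_mul_prim hg (L2_integrable h)
  rw [integral_mul_prim (L2_integrable h) hg, ← integral_const_mul,
    ← integral_sub (hg.const_mul _) hi]
  exact integral_congr_ae (Eventually.of_forall fun x => by ring)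

theorem inner_toLp (w : L2 Omega) {f : ℝ → ℝ} (hf : MemLp f 2 (volume.restrict Omega)) :
    inner ℝ hf.toLp w = ∫ x in Omega, f x * w x := by
  rw [L2_inner_eq]
  refine integral_congr_ae ?_
  filter_upwards [hf.coeFn_toLp] with x hx
  rw [hx]

/-- Elements of `H¹₀(0,1)` are the primitives of their weak derivatives, which have mean zero. -/
theorem H10_ae_eq_prim (u : H10 Omega) :
    (∀ᵐ x ∂volume.restrict Omega, u.fn x = prim u.grad x) ∧ ∫ x in Omega, u.grad x = 0 := by
  -- Tested against all `h` in `L²`, and with the primitive moved onto `h`, both claims become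
  -- closed conditions on the pair. They hold for test functions, hence on the closure.
  have key : ∀ w ∈ H10Submodule Omega,
      (∀ h : L2 Omega, inner ℝ h w.fst = inner ℝ (memLp_tail h).toLp w.snd) ∧
      inner ℝ ((memLp_const 1).toLp : L2 Omega) w.snd = 0 := by
    intro w hw
    have c1 := (WithLp.fstL 2 ℝ (L2 Omega) (L2 Omega)).continuous
    have c2 := (WithLp.sndL 2 ℝ (L2 Omega) (L2 Omega)).continuous
    refine closure_minimal (s := (testPairs Omega : Set (L2Pair Omega)))
      (t := {w | (∀ h : L2 Omega, inner ℝ h w.fst = inner ℝ (memLp_tail h).toLp w.snd) ∧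
      inner ℝ ((memLp_const 1).toLp : L2 Omega) w.snd = 0}) ?_ ?_ hw
    · rintro w ⟨φ, hφ, hw1, hw2⟩
      refine ⟨fun h => ?_, ?_⟩
      · rw [inner_toLp, L2_inner_eq]
        have e1 : ∫ x in Omega, h x * w.fst x = ∫ x in Omega, h x * prim (deriv φ) x :=
          integral_congr_ae (by
            filter_upwards [hw1] with x hx
            rw [hx, hφ.prim_deriv])
        rw [e1, integral_mul_tail h (integrable_of_memLp_two (hφ.memLp_deriv 2))]
        refine integral_congr_ae ?_
        filter_upwards [hw2] with x hx
        rw [hx]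
      · rw [inner_toLp, ← hφ.integral_deriv]
        refine integral_congr_ae ?_
        filter_upwards [hw2] with x hx
        rw [hx, one_mul]
    · rw [ofPred_and, ofPred_forall]
      exact (isClosed_iInter fun h => isClosed_eq (continuous_const.inner c1)
        (continuous_const.inner c2)).inter (isClosed_eq (continuous_const.inner c2)
          continuous_const)
  obtain ⟨k1, k2⟩ := key u u.2
  have hp := memLp_prim (L2_integrable u.grad) 2
  constructor
  · have : u.fn = hp.toLp := by
      refine ext_inner_left ℝ fun h => ?_
      rw [real_inner_comm _ hp.toLp |>.symm, inner_toLp, H10.fn, k1 h, inner_toLp]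
      rw [← H10.grad, ← integral_mul_tail h (L2_integrable u.grad)]
      exact integral_congr_ae (Eventually.of_forall fun x => mul_comm _ _)
    rw [this]
    exact hp.coeFn_toLp
  · rw [inner_toLp] at k2
    simpa [H10.grad] using k2

/-- An `L²` function with mean zero is the weak derivative of an element of `H¹₀(0,1)`. -/
theorem exists_H10_of_integral_eq_zero {g : ℝ → ℝ} (hg : MemLp g 2 (volume.restrict Omega))
    (h0 : ∫ x in Omega, g x = 0) :
    ∃ u : H10 Omega, (∀ᵐ x ∂volume.restrict Omega, u.fn x = prim g x) ∧
      ∀ᵐ x ∂volume.restrict Omega, u.grad x = g x := by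
  have ig := integrable_of_memLp_two hg
  have hp := memLp_prim ig 2
  let w : L2Pair Omega := WithLp.toLp 2 (hp.toLp, hg.toLp)
  have hw : w ∈ H10Submodule Omega := by
    -- The closure is the double orthogonal complement. If `v` is orthogonal to all test pairs, du
    -- Bois-Reymond makes `v.snd` plus the tail of `v.fst` constant, and a constant is orthogonal to
    -- the mean-zero `g`.
    rw [H10Submodule, ← Submodule.orthogonal_orthogonal_eq_closure, Submodule.mem_orthogonal]
    intro v hv
    rw [Submodule.mem_orthogonal] at hv
    have hm : MemLp (fun x => v.snd x + ((∫ t in Omega, v.fst t) - prim v.fst x)) 2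
        (volume.restrict Omega) := (Lp.memLp v.snd).add (memLp_tail v.fst)
    have i1 : ∀ f : ℝ → ℝ, MemLp f 2 (volume.restrict Omega) →
        (∫ x in Omega, v.fst x * prim f x) + ∫ x in Omega, v.snd x * f x
        = ∫ x in Omega, (v.snd x + ((∫ t in Omega, v.fst t) - prim v.fst x)) * f x := by
      intro f hf
      rw [integral_mul_tail v.fst (integrable_of_memLp_two hf), add_comm, ← integral_add
        (integrable_mul_of_memLp (Lp.memLp _) hf) (integrable_mul_of_memLp (memLp_tail _) hf)]
      exact integral_congr_ae (Eventually.of_forall fun x => by simp only; ring)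
    obtain ⟨c, hc⟩ := ae_eq_const_of_integral_mul_deriv hm (by
      intro φ hφ
      have hmem : (WithLp.toLp 2 ((hφ.memLp 2).toLp, (hφ.memLp_deriv 2).toLp) : L2Pair Omega)
          ∈ testPairs Omega :=
        ⟨φ, hφ, (hφ.memLp 2).coeFn_toLp, (hφ.memLp_deriv 2).coeFn_toLp⟩
      have e := hv _ hmem
      rw [WithLp.prod_inner_apply] at e
      simp only [WithLp.ofLp_fst, WithLp.ofLp_snd, inner_toLp] at e
      rw [← i1 _ (hφ.memLp_deriv 2), ← e]
      congr 1
      · exact integral_congr_ae (Eventually.of_forall fun x => by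
          simp only [hφ.prim_deriv, mul_comm])
      · exact integral_congr_ae (Eventually.of_forall fun x => mul_comm _ _))
    rw [WithLp.prod_inner_apply]
    simp only [WithLp.ofLp_fst, WithLp.ofLp_snd]
    rw [show w.fst = hp.toLp from rfl, show w.snd = hg.toLp from rfl, real_inner_comm,
      real_inner_comm _ v.snd, inner_toLp, inner_toLp]
    simp only [mul_comm (prim g _), mul_comm (g _)]
    rw [i1 g hg]
    have : ∫ x in Omega, (v.snd x + ((∫ t in Omega, v.fst t) - prim v.fst x)) * g x
        = ∫ x in Omega, c * g x := integral_congr_ae (by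
      filter_upwards [hc] with x hx
      rw [hx])
    rw [this, integral_const_mul, h0, mul_zero]
  exact ⟨⟨w, hw⟩, hp.coeFn_toLp, hg.coeFn_toLp⟩

theorem H10_ext {u v : H10 Omega}
    (h : ∀ᵐ x ∂volume.restrict Omega, u.grad x = v.grad x) : u = v := by
  obtain ⟨hu, -⟩ := H10_ae_eq_prim u
  obtain ⟨hv, -⟩ := H10_ae_eq_prim v
  have h1 : u.grad = v.grad := Lp.ext h
  have h2 : u.fn = v.fn := Lp.ext (by
    filter_upwards [hu, hv] with x h3 h4
    rw [h3, h4, h1])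
  refine Subtype.ext (WithLp.ofLp_injective 2 (Prod.ext h2 h1))

/-- The boundary term of the integration by parts carries the mean of `ψ.grad`, which is zero. -/
theorem integral_mul_fn {k : ℝ → ℝ} (hk : Integrable k (volume.restrict Omega))
    (ψ : H10 Omega) :
    ∫ x in Omega, k x * ψ.fn x = - ∫ x in Omega, prim k x * ψ.grad x := by
  obtain ⟨h1, h2⟩ := H10_ae_eq_prim ψ
  have : ∫ x in Omega, k x * ψ.fn x = ∫ x in Omega, k x * prim ψ.grad x :=
    integral_congr_ae (by
      filter_upwards [h1] with x hx
      rw [hx])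
  rw [this, integral_mul_prim hk (L2_integrable _), h2, mul_zero, zero_sub]

/-- The du Bois-Reymond lemma in `H¹₀(0,1)`. -/
theorem forall_integral_mul_grad_eq_zero_iff {h : ℝ → ℝ}
    (hh : MemLp h 2 (volume.restrict Omega)) :
    (∀ φ : H10 Omega, ∫ x in Omega, h x * φ.grad x = 0) ↔
      ∃ c : ℝ, ∀ᵐ x ∂volume.restrict Omega, h x = c := by
  constructor
  · intro h0
    refine ae_eq_const_of_integral_mul_deriv hh fun φ hφ => ?_
    obtain ⟨u, -, hu⟩ := exists_H10_of_integral_eq_zero (hφ.memLp_deriv 2) hφ.integral_deriv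
    rw [← h0 u]
    refine integral_congr_ae ?_
    filter_upwards [hu] with x hx
    rw [hx]
  · rintro ⟨c, hc⟩ φ
    have : ∫ x in Omega, h x * φ.grad x = ∫ x in Omega, c * φ.grad x :=
      integral_congr_ae (by
        filter_upwards [hc] with x hx
        rw [hx])
    rw [this, integral_const_mul, (H10_ae_eq_prim φ).2, mul_zero]

/-! ### Gronwall's inequality and uniqueness for the Hamilton–Jacobi equation -/

/-- Gronwall's inequality in integral form, with zero initial value. -/
theorem eq_zero_of_abs_le_integral {w : ℝ → ℝ} (hw : Continuous w) {a b K : ℝ} (hK : 0 ≤ K)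
    (h : ∀ x ∈ Icc a b, |w x| ≤ K * ∫ t in a..x, |w t|) : ∀ x ∈ Icc a b, w x = 0 := by
  intro x hx
  have hd : ∀ x, HasDerivAt (fun x => ∫ t in a..x, |w t|) |w x| x := fun x =>
    intervalIntegral.integral_hasDerivAt_right (hw.abs.intervalIntegrable _ _)
      (hw.abs.stronglyMeasurableAtFilter _ _) hw.abs.continuousAt
  have hpos : ∀ x ∈ Icc a b, 0 ≤ ∫ t in a..x, |w t| := fun x hx =>
    intervalIntegral.integral_nonneg hx.1 fun _ _ => abs_nonneg _
  -- The differential Gronwall inequality is applied to the primitive of `|w|`, whose derivative is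
  -- `|w|`.
  have := norm_le_gronwallBound_of_norm_deriv_right_le (f := fun x => ∫ t in a..x, |w t|)
    (f' := fun x => |w x|) (δ := 0) (K := K) (ε := 0) (a := a) (b := b)
    (fun x _ => (hd x).continuousAt.continuousWithinAt)
    (fun x _ => (hd x).hasDerivWithinAt) (by simp)
    (fun x hx => by
      have hx' := Ico_subset_Icc_self hx
      rw [Real.norm_eq_abs, abs_abs, Real.norm_eq_abs, abs_of_nonneg (hpos x hx'), add_zero]
      exact h x hx') x hx
  rw [gronwallBound_ε0, zero_mul, Real.norm_eq_abs, abs_of_nonneg (hpos x hx)] at this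
  have h2 := h x hx
  exact abs_nonpos_iff.1 (h2.trans (mul_nonpos_of_nonneg_of_nonpos hK this))

/-- A two-sided version for an interior base point `c`; the part left of `c` follows by the
reflection `t ↦ -t`. -/
theorem eq_zero_of_abs_le_abs_integral {w : ℝ → ℝ} (hw : Continuous w) {a b c K : ℝ}
    (hK : 0 ≤ K) (hc : c ∈ Icc a b)
    (h : ∀ x ∈ Icc a b, |w x| ≤ K * |(∫ t in c..x, |w t|)|) : ∀ x ∈ Icc a b, w x = 0 := by
  intro x hx
  rcases le_total c x with hcx | hcx
  · refine eq_zero_of_abs_le_integral hw hK (a := c) (b := b) (fun y hy => ?_) x ⟨hcx, hx.2⟩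
    have := h y ⟨hc.1.trans hy.1, hy.2⟩
    rwa [abs_of_nonneg (intervalIntegral.integral_nonneg hy.1 fun _ _ => abs_nonneg _)] at this
  · have := eq_zero_of_abs_le_integral (w := fun t => w (-t)) (by fun_prop) hK (a := -c)
      (b := -a) (fun y hy => ?_) (-x) ⟨by linarith, by linarith [hx.1]⟩
    · simpa using this
    · have h1 := h (-y) ⟨by linarith [hy.2], by linarith [hy.1, hc.2]⟩
      rw [intervalIntegral.integral_comp_neg (fun t => |w t|), neg_neg]
      rwa [intervalIntegral.integral_symm, abs_neg, abs_of_nonneg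
        (intervalIntegral.integral_nonneg (by linarith [hy.1]) fun _ _ => abs_nonneg _)] at h1

theorem prim_one (x : ℝ) : prim (fun _ => 1) x = x := by simp [prim]

/-- The Hamilton–Jacobi equation in `H¹₀(0,1)` has only the trivial solution when its
zeroth-order term is dominated by the gradient. -/
theorem eq_zero_of_hamiltonJacobi {ν : ℝ} (hν : 0 < ν) (u : H10 Omega) {k : ℝ → ℝ}
    (hk : MemLp k 2 (volume.restrict Omega))
    (hle : ∀ᵐ x ∂volume.restrict Omega, |k x| ≤ |u.grad x|)
    (h : ∀ ψ : H10 Omega, ∫ x in Omega, (ν * u.grad x * ψ.grad x + k x * ψ.fn x) = 0) :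
    u = 0 := by
  have ik := integrable_of_memLp_two hk
  have hm : MemLp (fun x => ν * u.grad x - prim k x) 2 (volume.restrict Omega) :=
    ((Lp.memLp u.grad).const_mul ν).sub (memLp_prim ik 2)
  obtain ⟨c, hc⟩ := (forall_integral_mul_grad_eq_zero_iff hm).1 fun ψ => by
    have i1 := integrable_mul_of_memLp ((Lp.memLp u.grad).const_mul ν) (Lp.memLp ψ.grad)
    have i2 := integrable_mul_of_memLp hk (Lp.memLp ψ.fn)
    have i3 := integrable_mul_of_memLp (memLp_prim ik 2) (Lp.memLp ψ.grad)
    have e := h ψ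
    rw [integral_add i1 i2, integral_mul_fn ik, ← sub_eq_add_neg, ← integral_sub i1 i3] at e
    rw [← e]
    exact integral_congr_ae (Eventually.of_forall fun x => by ring)
  have ik' : Integrable (Omega.indicator k) := (integrable_indicator_iff measurableSet_Omega).2 ik
  have hkk : Omega.indicator k =ᵐ[volume.restrict Omega] k :=
    indicator_ae_eq_restrict measurableSet_Omega
  -- A continuous representative of `u'`, from the once-integrated equation `ν u' = c + prim k`; the
  -- indicator makes it defined and continuous on all of `ℝ`.
  set w : ℝ → ℝ := fun x => (c + ∫ t in (0 : ℝ)..x, Omega.indicator k t) / ν with hw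
  have hwc : Continuous w := (continuous_const.add (intervalIntegral.continuous_primitive
    (fun a b => ik'.intervalIntegrable) 0)).div_const _
  have h01 : (0 : ℝ) ∈ Icc (0 : ℝ) 1 := by simp
  have huw : ∀ᵐ x ∂volume.restrict Omega, u.grad x = w x := by
    filter_upwards [hc, ae_restrict_mem measurableSet_Omega] with x h1 h2
    rw [hw]
    simp only
    rw [intervalIntegral_congr_ae_Omega hkk h01 (Ioo_subset_Icc_self h2), ← h1, prim]
    field_simp
    ring
  have hint : ∫ x in (0 : ℝ)..1, w x = 0 := by
    rw [← setIntegral_Omega, ← (H10_ae_eq_prim u).2]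
    exact integral_congr_ae (huw.mono fun x hx => hx.symm)
  -- Since `u'` has mean zero, Rolle's theorem gives it a zero, which replaces an initial condition.
  obtain ⟨x₀, hx₀, hz⟩ := exists_hasDerivAt_eq_zero (f := fun x => ∫ t in (0 : ℝ)..x, w t)
    (f' := w) zero_lt_one (intervalIntegral.continuous_primitive
      (fun a b => hwc.intervalIntegrable a b) 0).continuousOn (by simp [hint])
    (fun x _ => intervalIntegral.integral_hasDerivAt_right (hwc.intervalIntegrable _ _)
      (hwc.stronglyMeasurableAtFilter _ _) hwc.continuousAt)
  have hkw : ∀ᵐ x ∂volume, |Omega.indicator k x| ≤ |w x| := by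
    have : ∀ᵐ x ∂volume.restrict Omega, |k x| ≤ |w x| := by
      filter_upwards [hle, huw] with x h1 h2
      rwa [← h2]
    filter_upwards [(ae_restrict_iff' measurableSet_Omega).1 this] with x hx
    by_cases hxo : x ∈ Omega
    · simpa [hxo] using hx hxo
    · simp [hxo]
  have hw0 := eq_zero_of_abs_le_abs_integral hwc (K := 1 / ν) (by positivity)
    (Ioo_subset_Icc_self hx₀) (a := 0) (b := 1) (fun x _ => by
      have e : w x = (∫ t in x₀..x, Omega.indicator k t) / ν := by
        rw [← sub_zero (w x), ← hz, hw]
        simp only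
        rw [← intervalIntegral.integral_interval_sub_left (a := 0) (b := x) (c := x₀)
          ik'.intervalIntegrable ik'.intervalIntegrable]
        ring
      rw [e, abs_div, abs_of_pos hν, div_eq_mul_one_div, mul_comm]
      refine mul_le_mul_of_nonneg_left ?_ (by positivity)
      exact intervalIntegral.norm_integral_le_abs_of_norm_le
        (f := Omega.indicator k) (g := fun t => |w t|) (ae_restrict_of_ae hkw)
        (hwc.abs.intervalIntegrable _ _))
  refine H10_ext ?_
  filter_upwards [huw, ae_restrict_mem measurableSet_Omega,
    Lp.coeFn_zero ℝ 2 (volume.restrict Omega)] with x h1 h2 h3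
  rw [h1, hw0 x (Ioo_subset_Icc_self h2)]
  exact h3.symm

/-! ### The Fokker–Planck equation solved by an integrating factor -/

theorem integral_fn (φ : H10 Omega) :
    ∫ x in Omega, φ.fn x = - ∫ x in Omega, x * φ.grad x := by
  have := integral_mul_fn (integrable_const (1 : ℝ)) φ
  simpa [prim_one] using this

theorem memLp_id : MemLp (fun x : ℝ => x) 2 (volume.restrict Omega) :=
  memLp_of_continuousOn continuousOn_id 2

theorem memLp_mul_continuous {f b : ℝ → ℝ} (hf : MemLp f 2 (volume.restrict Omega))
    (hb : Continuous b) : MemLp (fun x => f x * b x) 2 (volume.restrict Omega) := by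
  have h := hf.mul (r := 2) (memLp_of_continuousOn hb.continuousOn ∞)
  refine h.ae_eq (Eventually.of_forall fun x => ?_)
  simp [mul_comm]

/-- The Fokker–Planck equation with unit source, integrated once. -/
theorem fokkerPlanck_iff_ae_eq_const {ν : ℝ} {b : ℝ → ℝ} (hb : Continuous b) (m : H10 Omega) :
    (∀ φ : H10 Omega, ∫ x in Omega, (ν * m.grad x * φ.grad x + m.fn x * b x * φ.grad x)
        = ∫ x in Omega, φ.fn x) ↔
      ∃ c : ℝ, ∀ᵐ x ∂volume.restrict Omega, ν * m.grad x + m.fn x * b x + x = c := by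
  have h1 : MemLp (fun x => ν * m.grad x + m.fn x * b x) 2 (volume.restrict Omega) :=
    ((Lp.memLp m.grad).const_mul ν).add (memLp_mul_continuous (Lp.memLp m.fn) hb)
  have hm : MemLp (fun x => ν * m.grad x + m.fn x * b x + x) 2 (volume.restrict Omega) :=
    h1.add memLp_id
  rw [← forall_integral_mul_grad_eq_zero_iff hm]
  refine forall_congr' fun φ => ?_
  have i1 := integrable_mul_of_memLp h1 (Lp.memLp φ.grad)
  have i2 := integrable_mul_of_memLp memLp_id (Lp.memLp φ.grad)
  rw [integral_fn, eq_neg_iff_add_eq_zero]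
  have : ∫ x in Omega, (ν * m.grad x + m.fn x * b x + x) * φ.grad x
      = (∫ x in Omega, (ν * m.grad x * φ.grad x + m.fn x * b x * φ.grad x))
        + ∫ x in Omega, x * φ.grad x := by
    simp only [← add_mul]
    rw [← integral_add i1 i2]
    exact integral_congr_ae (Eventually.of_forall fun x => by ring)
  rw [this]

/-- The constant flux `ν m' + b m + x` of the solution of the Fokker–Planck equation with drift
`b = ν B'` and unit source. -/
noncomputable def fluxConst (B : ℝ → ℝ) : ℝ :=
  (∫ t in (0 : ℝ)..1, t * Real.exp (B t)) / ∫ t in (0 : ℝ)..1, Real.exp (B t)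

/-- The solution of the Fokker–Planck equation with drift `b = ν B'` and unit source. -/
noncomputable def density (ν : ℝ) (B : ℝ → ℝ) (x : ℝ) : ℝ :=
  Real.exp (-B x) / ν * ∫ t in (0 : ℝ)..x, Real.exp (B t) * (fluxConst B - t)

theorem integral_exp_pos {B : ℝ → ℝ} (hB : Continuous B) :
    0 < ∫ t in (0 : ℝ)..1, Real.exp (B t) :=
  intervalIntegral.intervalIntegral_pos_of_pos ((by fun_prop :
    Continuous fun t => Real.exp (B t)).intervalIntegrable _ _)
    (fun _ => Real.exp_pos _) zero_lt_one

/-- It shows that `fluxConst B` is the only constant for which the integrated equation vanishes at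
`1`. -/
theorem integral_exp_mul_const_sub {B : ℝ → ℝ} (hB : Continuous B) (c : ℝ) :
    ∫ t in (0 : ℝ)..1, Real.exp (B t) * (c - t)
      = (c - fluxConst B) * ∫ t in (0 : ℝ)..1, Real.exp (B t) := by
  have h := (integral_exp_pos hB).ne'
  have e : ∫ t in (0 : ℝ)..1, Real.exp (B t) * (c - t)
      = c * (∫ t in (0 : ℝ)..1, Real.exp (B t)) - ∫ t in (0 : ℝ)..1, t * Real.exp (B t) := by
    rw [← intervalIntegral.integral_const_mul, ← intervalIntegral.integral_sub]
    · exact intervalIntegral.integral_congr fun t _ => by ring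
    · exact (by fun_prop : Continuous _).intervalIntegrable _ _
    · exact (by fun_prop : Continuous _).intervalIntegrable _ _
  rw [e, fluxConst, sub_mul, div_mul_cancel₀ _ h]

section

variable {ν : ℝ} {b B : ℝ → ℝ}

theorem hasDerivAt_density (hν : 0 < ν) (hB : ∀ x, HasDerivAt B (b x / ν) x) (x : ℝ) :
    HasDerivAt (density ν B) ((fluxConst B - x - b x * density ν B x) / ν) x := by
  have hBc : Continuous B := continuous_iff_continuousAt.2 fun x => (hB x).continuousAt
  have hc : Continuous fun t => Real.exp (B t) * (fluxConst B - t) := by fun_prop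
  have h1 := intervalIntegral.integral_hasDerivAt_right (hc.intervalIntegrable 0 x)
    (hc.stronglyMeasurableAtFilter _ _) hc.continuousAt
  have h2 := ((hB x).neg.exp.div_const ν).mul h1
  refine h2.congr_deriv ?_
  have : Real.exp (-B x) * Real.exp (B x) = 1 := by rw [← Real.exp_add]; simp
  rw [density]
  field_simp
  linear_combination ν * (fluxConst B - x) * this

theorem density_zero : density ν B 0 = 0 := by simp [density]

theorem density_one (hB : Continuous B) : density ν B 1 = 0 := by
  rw [density, integral_exp_mul_const_sub hB, sub_self, zero_mul, mul_zero]

theorem continuous_density (hν : 0 < ν) (hB : ∀ x, HasDerivAt B (b x / ν) x) :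
    Continuous (density ν B) :=
  continuous_iff_continuousAt.2 fun x => (hasDerivAt_density hν hB x).continuousAt

/-- The density vanishes at both endpoints, so its derivative has mean zero and defines an element
of `H¹₀`. -/
theorem exists_fokkerPlanck_solution (hν : 0 < ν) (hb : Continuous b)
    (hB : ∀ x, HasDerivAt B (b x / ν) x) : ∃ m : H10 Omega,
      (∀ᵐ x ∂volume.restrict Omega, m.fn x = density ν B x) ∧
      ∀ᵐ x ∂volume.restrict Omega,
        m.grad x = (fluxConst B - x - b x * density ν B x) / ν := by
  have hBc : Continuous B := continuous_iff_continuousAt.2 fun x => (hB x).continuousAt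
  have hM := continuous_density hν hB
  have hg : Continuous fun x => (fluxConst B - x - b x * density ν B x) / ν := by fun_prop
  have hprim : ∀ x, prim (fun x => (fluxConst B - x - b x * density ν B x) / ν) x
      = density ν B x := fun x => by
    rw [prim, intervalIntegral.integral_eq_sub_of_hasDerivAt
      (fun x _ => hasDerivAt_density hν hB x) (hg.intervalIntegrable _ _), density_zero, sub_zero]
  obtain ⟨m, h1, h2⟩ := exists_H10_of_integral_eq_zero
    (memLp_of_continuousOn hg.continuousOn 2) (by
      rw [setIntegral_Omega]
      exact (hprim 1).trans (density_one hBc))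
  exact ⟨m, h1.mono fun x hx => hx.trans (hprim x), h2⟩

/-- Uniqueness: the integrating factor determines `m` from `c`, and the boundary value at `1` then
forces `c = fluxConst B`. -/
theorem ae_grad_eq_of_fokkerPlanck (hν : 0 < ν) (hb : Continuous b)
    (hB : ∀ x, HasDerivAt B (b x / ν) x) {m : H10 Omega} {c : ℝ}
    (hm : ∀ᵐ x ∂volume.restrict Omega, ν * m.grad x + m.fn x * b x + x = c) :
    ∀ᵐ x ∂volume.restrict Omega,
        m.grad x = (fluxConst B - x - b x * density ν B x) / ν := by
  have hBc : Continuous B := continuous_iff_continuousAt.2 fun x => (hB x).continuousAt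
  obtain ⟨hm1, hm2⟩ := H10_ae_eq_prim m
  have hPc := continuousOn_prim (L2_integrable m.grad)
  -- A globally continuous version of `m`, so that the right-hand side of the equation is
  -- continuous.
  set P : ℝ → ℝ := IccExtend zero_le_one ((Icc (0 : ℝ) 1).domRestrict (prim m.grad)) with hP
  have hPcont : Continuous P := hPc.domRestrict.Icc_extend'
  have hPeq : ∀ x ∈ Icc (0 : ℝ) 1, P x = prim m.grad x := fun x hx => by
    rw [hP, IccExtend_of_mem _ _ hx, domRestrict_apply]
  have hg : Continuous fun t => (c - t - b t * P t) / ν := by fun_prop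
  have hgrad : ∀ᵐ x ∂volume.restrict Omega, m.grad x = (c - x - b x * P x) / ν := by
    filter_upwards [hm, hm1, ae_restrict_mem measurableSet_Omega] with x h1 h2 h3
    rw [hPeq x (Ioo_subset_Icc_self h3), ← h2, ← h1]
    field_simp
    ring
  -- `E` agrees with `P` on `[0,1]` but is differentiable everywhere, so the product rule applies to
  -- `exp B * E`.
  set E : ℝ → ℝ := fun x => ∫ t in (0 : ℝ)..x, (c - t - b t * P t) / ν with hE
  have hEd : ∀ x, HasDerivAt E ((c - x - b x * P x) / ν) x := fun x =>
    intervalIntegral.integral_hasDerivAt_right (hg.intervalIntegrable _ _)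
      (hg.stronglyMeasurableAtFilter _ _) hg.continuousAt
  have hEP : ∀ x ∈ Icc (0 : ℝ) 1, P x = E x := fun x hx => by
    rw [hPeq x hx, prim, hE]
    exact intervalIntegral_congr_ae_Omega hgrad (by simp) hx
  have hsol : ∀ x ∈ Icc (0 : ℝ) 1,
      ∫ t in (0 : ℝ)..x, Real.exp (B t) * (c - t) = ν * (Real.exp (B x) * E x) := by
    intro x hx
    have hd : ∀ t ∈ uIcc 0 x, HasDerivAt (fun t => ν * (Real.exp (B t) * E t))
        (Real.exp (B t) * (c - t)) t := by
      intro t ht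
      rw [uIcc_of_le hx.1] at ht
      refine (((hB t).exp.mul (hEd t)).const_mul ν).congr_deriv ?_
      rw [hEP t ⟨ht.1, ht.2.trans hx.2⟩]
      field_simp
      ring
    rw [intervalIntegral.integral_eq_sub_of_hasDerivAt hd
      ((by fun_prop : Continuous _).intervalIntegrable _ _)]
    simp [hE]
  have hE1 : E 1 = 0 := by
    rw [← hEP 1 (by simp), hPeq 1 (by simp), prim, ← setIntegral_Omega, hm2]
  have hcC : c = fluxConst B := by
    have h1 := hsol 1 (by simp)
    rw [hE1, mul_zero, mul_zero, integral_exp_mul_const_sub hBc] at h1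
    exact sub_eq_zero.1 ((mul_eq_zero.1 h1).resolve_right (integral_exp_pos hBc).ne')
  filter_upwards [hgrad, ae_restrict_mem measurableSet_Omega] with x h1 h2
  have h2' := Ioo_subset_Icc_self h2
  rw [h1, hcC, hEP x h2', density, ← hcC, hsol x h2']
  have : Real.exp (-B x) * Real.exp (B x) = 1 := by rw [← Real.exp_add]; simp
  congr 3
  field_simp
  linear_combination -E x * this

theorem fokkerPlanck_iff (hν : 0 < ν) (hb : Continuous b)
    (hB : ∀ x, HasDerivAt B (b x / ν) x) {w : H10 Omega}
    (hw1 : ∀ᵐ x ∂volume.restrict Omega, w.fn x = density ν B x)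
    (hw2 : ∀ᵐ x ∂volume.restrict Omega,
        w.grad x = (fluxConst B - x - b x * density ν B x) / ν) (m : H10 Omega) :
    (∀ φ : H10 Omega, ∫ x in Omega, (ν * m.grad x * φ.grad x + m.fn x * b x * φ.grad x)
        = ∫ x in Omega, φ.fn x) ↔ m = w := by
  rw [fokkerPlanck_iff_ae_eq_const hb]
  constructor
  · rintro ⟨c, hc⟩
    refine H10_ext ?_
    filter_upwards [ae_grad_eq_of_fokkerPlanck hν hb hB hc, hw2] with x h1 h2
    rw [h1, h2]
  · rintro rfl
    refine ⟨fluxConst B, ?_⟩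
    filter_upwards [hw1, hw2] with x h1 h2
    rw [h1, h2]
    field_simp
    ring

end

/-! ### Limits: Riemann–Lebesgue, dominated convergence, vanishing potentials -/

/-- The Riemann–Lebesgue lemma for cosines on `(0,1)`. -/
theorem tendsto_integral_mul_cos {f : ℝ → ℝ} (hf : Integrable f (volume.restrict Omega))
    {s : ℕ → ℝ} (hs : Tendsto s atTop atTop) :
    Tendsto (fun j => ∫ x in Omega, f x * Real.cos (s j * x)) atTop (𝓝 0) := by
  set F : ℝ → ℂ := fun x => ((Omega.indicator f x : ℝ) : ℂ) with hF
  have hFi : Integrable F := ((integrable_indicator_iff measurableSet_Omega).2 hf).ofReal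
  have h1 := Real.tendsto_integral_exp_smul_cocompact F
  -- The Fourier character carries a factor `2π`, so the frequency is rescaled; the cosine is the
  -- real part.
  have h2 : Tendsto (fun j => s j / (2 * Real.pi)) atTop (cocompact ℝ) :=
    (hs.atTop_div_const (by positivity)).mono_right atTop_le_cocompact
  have h3 := (Complex.continuous_re.tendsto _).comp (h1.comp h2)
  rw [Complex.zero_re] at h3
  refine h3.congr fun j => ?_
  simp only [Function.comp_apply]
  have hi : Integrable fun v : ℝ => Real.fourierChar (-(v * (s j / (2 * Real.pi)))) • F v := by
    have := (Real.fourierIntegral_convergent_iff (μ := volume) (f := F)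
      (s j / (2 * Real.pi))).2 hFi
    simpa [mul_comm] using this
  rw [← Complex.reCLM_apply, ← Complex.reCLM.integral_comp_comm hi,
    ← integral_indicator measurableSet_Omega]
  refine integral_congr_ae (Eventually.of_forall fun x => ?_)
  have e : 2 * Real.pi * -(x * (s j / (2 * Real.pi))) = -(s j * x) := by
    field_simp
  simp only [Complex.reCLM_apply, Circle.smul_def, Real.fourierChar_apply, e, smul_eq_mul]
  rw [hF, Complex.re_mul_ofReal, Complex.exp_ofReal_mul_I_re, Real.cos_neg]
  by_cases hx : x ∈ Omega
  · simp [hx, mul_comm]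
  · simp [hx]

/-- Dominated convergence in `L²(0,1)`. -/
theorem tendsto_norm_zero_of_bounded {F : ℕ → L2 Omega} {f : ℕ → ℝ → ℝ} {K : ℝ}
    (hF : ∀ j, ∀ᵐ x ∂volume.restrict Omega, F j x = f j x)
    (hK : ∀ j, ∀ x ∈ Icc (0 : ℝ) 1, |f j x| ≤ K)
    (hlim : ∀ x ∈ Icc (0 : ℝ) 1, Tendsto (fun j => f j x) atTop (𝓝 0)) :
    Tendsto (fun j => ‖F j‖) atTop (𝓝 0) := by
  have h1 : Tendsto (fun j => ∫ x in Omega, F j x * F j x) atTop (𝓝 (∫ x in Omega, (0 : ℝ))) := by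
    refine tendsto_integral_of_dominated_convergence (fun _ => K * K)
      (fun j => (Lp.aestronglyMeasurable _).mul (Lp.aestronglyMeasurable _))
      (integrable_const _) (fun j => ?_) ?_
    · filter_upwards [hF j, ae_Omega (hK j)] with x h1 h2
      rw [h1, norm_mul, Real.norm_eq_abs]
      exact mul_le_mul h2 h2 (abs_nonneg _) ((abs_nonneg _).trans h2)
    · filter_upwards [ae_all_iff.2 hF, ae_Omega hlim] with x h1 h2
      simpa [h1] using h2.mul h2
  have h2 : ∀ j, ‖F j‖ = √(∫ x in Omega, F j x * F j x) := fun j => by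
    rw [← L2_inner_eq, real_inner_self_eq_norm_sq, Real.sqrt_sq (norm_nonneg _)]
  simp only [h2]
  simpa using h1.sqrt

section

variable {B : ℕ → ℝ → ℝ} {K : ℝ}

theorem tendsto_integral_mul_exp (hB : ∀ j, Continuous (B j))
    (hK : ∀ j, ∀ x ∈ Icc (0 : ℝ) 1, |B j x| ≤ K)
    (hlim : ∀ x ∈ Icc (0 : ℝ) 1, Tendsto (fun j => B j x) atTop (𝓝 0))
    {g : ℕ → ℝ → ℝ} {g₀ : ℝ → ℝ} {K' : ℝ} (hg : ∀ j, Continuous (g j))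
    (hgK : ∀ j, ∀ x ∈ Icc (0 : ℝ) 1, |g j x| ≤ K')
    (hglim : ∀ x ∈ Icc (0 : ℝ) 1, Tendsto (fun j => g j x) atTop (𝓝 (g₀ x)))
    {x : ℝ} (hx : x ∈ Icc (0 : ℝ) 1) :
    Tendsto (fun j => ∫ t in (0 : ℝ)..x, g j t * Real.exp (B j t)) atTop
      (𝓝 (∫ t in (0 : ℝ)..x, g₀ t)) := by
  have hsub : ∀ t ∈ uIoc 0 x, t ∈ Icc (0 : ℝ) 1 := fun t ht => by
    rw [uIoc_of_le hx.1] at ht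
    exact ⟨ht.1.le, ht.2.trans hx.2⟩
  refine intervalIntegral.tendsto_integral_filter_of_dominated_convergence
    (fun _ => K' * Real.exp K) (Eventually.of_forall fun j => ?_)
    (Eventually.of_forall fun j => ae_of_all _ fun t ht => ?_) (by simp)
    (ae_of_all _ fun t ht => ?_)
  · have := hB j
    have := hg j
    exact (by fun_prop : Continuous fun t => g j t * Real.exp (B j t)).aestronglyMeasurable
  · rw [norm_mul, Real.norm_eq_abs, Real.norm_eq_abs, Real.abs_exp]
    exact mul_le_mul (hgK j t (hsub t ht))
      (Real.exp_le_exp.2 ((le_abs_self _).trans (hK j t (hsub t ht)))) (Real.exp_pos _).le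
      ((abs_nonneg _).trans (hgK j t (hsub t ht)))
  · simpa using (hglim t (hsub t ht)).mul
      ((Real.continuous_exp.tendsto 0).comp (hlim t (hsub t ht)))

/-- The constant is a weighted mean of `t` over `[0,1]`. -/
theorem fluxConst_mem_Icc {B : ℝ → ℝ} (hB : Continuous B) : fluxConst B ∈ Icc (0 : ℝ) 1 := by
  have h := integral_exp_pos hB
  have h0 : 0 ≤ ∫ t in (0 : ℝ)..1, t * Real.exp (B t) :=
    intervalIntegral.integral_nonneg zero_le_one fun t ht =>
      mul_nonneg ht.1 (Real.exp_pos _).le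
  refine ⟨div_nonneg h0 h.le, (div_le_one h).2 ?_⟩
  refine intervalIntegral.integral_mono_on zero_le_one
    ((by fun_prop : Continuous _).intervalIntegrable _ _)
    ((by fun_prop : Continuous _).intervalIntegrable _ _) fun t ht => ?_
  exact mul_le_of_le_one_left (Real.exp_pos _).le ht.2

theorem fluxConst_zero : fluxConst (fun _ => 0) = 1 / 2 := by
  simp [fluxConst]

theorem density_zero_potential (ν x : ℝ) :
    density ν (fun _ => 0) x = x * (1 - x) / (2 * ν) := by
  simp only [density, fluxConst_zero, neg_zero, Real.exp_zero, one_mul]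
  rw [intervalIntegral.integral_sub (by simp) intervalIntegral.intervalIntegrable_id]
  simp
  rcases eq_or_ne ν 0 with rfl | h
  · simp
  · field_simp

theorem tendsto_fluxConst (hB : ∀ j, Continuous (B j))
    (hK : ∀ j, ∀ x ∈ Icc (0 : ℝ) 1, |B j x| ≤ K)
    (hlim : ∀ x ∈ Icc (0 : ℝ) 1, Tendsto (fun j => B j x) atTop (𝓝 0)) :
    Tendsto (fun j => fluxConst (B j)) atTop (𝓝 (1 / 2)) := by
  have h1 := tendsto_integral_mul_exp hB hK hlim (g := fun _ t => t) (g₀ := fun t => t) (K' := 1)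
    (fun _ => continuous_id) (fun _ x hx => abs_le.2 ⟨by linarith [hx.1], hx.2⟩)
    (fun _ _ => tendsto_const_nhds) (x := 1) (by simp)
  have h2 := tendsto_integral_mul_exp hB hK hlim (g := fun _ _ => 1) (g₀ := fun _ => 1) (K' := 1)
    (fun _ => continuous_const) (by simp)
    (fun _ _ => tendsto_const_nhds) (x := 1) (by simp)
  simp only [one_mul] at h2
  have h3 : Tendsto (fun j => fluxConst (B j)) atTop _ := h1.div h2 (by simp)
  simpa using h3

theorem tendsto_density (hB : ∀ j, Continuous (B j))
    (hK : ∀ j, ∀ x ∈ Icc (0 : ℝ) 1, |B j x| ≤ K)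
    (hlim : ∀ x ∈ Icc (0 : ℝ) 1, Tendsto (fun j => B j x) atTop (𝓝 0)) (ν : ℝ)
    {x : ℝ} (hx : x ∈ Icc (0 : ℝ) 1) :
    Tendsto (fun j => density ν (B j) x) atTop (𝓝 (density ν (fun _ => 0) x)) := by
  have h1 := tendsto_integral_mul_exp hB hK hlim (g := fun j t => fluxConst (B j) - t)
    (g₀ := fun t => 1 / 2 - t) (K' := 1) (fun _ => by fun_prop)
    (fun j x hx => by
      have := fluxConst_mem_Icc (hB j)
      exact abs_le.2 ⟨by linarith [this.1, hx.2], by linarith [this.2, hx.1]⟩)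
    (fun x _ => (tendsto_fluxConst hB hK hlim).sub_const x) hx
  have h2 := ((Real.continuous_exp.tendsto _).comp (hlim x hx).neg).div_const ν
  have h3 := h2.mul h1
  simp only [density, fluxConst_zero]
  simpa [mul_comm] using h3

/-- A bound depending on `B` only through `K`, which provides the dominating constant for
convergence in `L²`. -/
theorem abs_density_le {ν : ℝ} (hν : 0 < ν) {B : ℝ → ℝ} (hB : Continuous B)
    (hK : ∀ x ∈ Icc (0 : ℝ) 1, |B x| ≤ K) {x : ℝ} (hx : x ∈ Icc (0 : ℝ) 1) :
    |density ν B x| ≤ Real.exp K / ν * Real.exp K := by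
  rw [density, abs_mul, abs_div, Real.abs_exp, abs_of_pos hν]
  have h1 : Real.exp (-B x) ≤ Real.exp K :=
    Real.exp_le_exp.2 ((neg_le_abs _).trans (hK x hx))
  have h2 : |∫ t in (0 : ℝ)..x, Real.exp (B t) * (fluxConst B - t)| ≤ Real.exp K := by
    have := intervalIntegral.norm_integral_le_of_norm_le_const (a := 0) (b := x)
      (C := Real.exp K) (f := fun t => Real.exp (B t) * (fluxConst B - t)) (fun t ht => by
        rw [uIoc_of_le hx.1] at ht
        have ht' : t ∈ Icc (0 : ℝ) 1 := ⟨ht.1.le, ht.2.trans hx.2⟩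
        have := fluxConst_mem_Icc hB
        rw [norm_mul, Real.norm_eq_abs, Real.norm_eq_abs, Real.abs_exp]
        calc _ ≤ Real.exp K * 1 := mul_le_mul
              (Real.exp_le_exp.2 ((le_abs_self _).trans (hK t ht')))
              (abs_le.2 ⟨by linarith [this.1, ht'.2], by linarith [this.2, ht'.1]⟩)
              (abs_nonneg _) (Real.exp_pos _).le
          _ = _ := mul_one _)
    refine this.trans (mul_le_of_le_one_right (Real.exp_pos _).le ?_)
    rw [sub_zero, abs_of_nonneg hx.1]
    exact hx.2
  exact mul_le_mul (by gcongr) h2 (abs_nonneg _) (by positivity)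

end

/-! ### The oscillating drift: strong and weak parts of the gradient -/

/-- The oscillating drift `-x cos (n x)`. -/
noncomputable def oscDrift (n x : ℝ) : ℝ := -x * Real.cos (n * x)

/-- A potential of the oscillating drift, divided by the diffusion `ν`. -/
noncomputable def oscPotential (ν n x : ℝ) : ℝ :=
  -(x * Real.sin (n * x) / n + Real.cos (n * x) / n ^ 2) / ν

theorem continuous_oscDrift (n : ℝ) : Continuous (oscDrift n) := by
  unfold oscDrift
  fun_prop

theorem hasDerivAt_oscPotential (ν : ℝ) {n : ℝ} (hn : n ≠ 0) (x : ℝ) :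
    HasDerivAt (oscPotential ν n) (oscDrift n x / ν) x := by
  have h0 : HasDerivAt (fun x : ℝ => n * x) n x := by
    simpa using (hasDerivAt_id x).const_mul n
  have h := ((((hasDerivAt_id x).mul h0.sin).div_const n).add
    (h0.cos.div_const (n ^ 2))).neg.div_const ν
  refine h.congr_deriv ?_
  simp only [oscDrift, id]
  congr 1
  field_simp
  ring

theorem continuous_oscPotential (ν : ℝ) {n : ℝ} (hn : n ≠ 0) : Continuous (oscPotential ν n) :=
  continuous_iff_continuousAt.2 fun x => (hasDerivAt_oscPotential ν hn x).continuousAt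

theorem abs_oscDrift_le (n : ℝ) {x : ℝ} (hx : x ∈ Icc (0 : ℝ) 1) : |oscDrift n x| ≤ 1 := by
  rw [oscDrift, abs_mul, abs_neg, abs_of_nonneg hx.1]
  exact mul_le_one₀ hx.2 (abs_nonneg _) (Real.abs_cos_le_one _)

/-- Integrating the oscillation gains a factor `1 / n`: the potential vanishes uniformly although
the drift only oscillates. -/
theorem abs_oscPotential_le {ν n : ℝ} (hν : 0 < ν) (hn : 1 ≤ n) {x : ℝ}
    (hx : x ∈ Icc (0 : ℝ) 1) : |oscPotential ν n x| ≤ 2 / ν * (1 / n) := by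
  have hn0 : 0 < n := by linarith
  rw [oscPotential, abs_div, abs_neg, abs_of_pos hν]
  have h1 : |x * Real.sin (n * x) / n| ≤ 1 / n := by
    rw [abs_div, abs_mul, abs_of_nonneg hx.1, abs_of_pos hn0]
    gcongr
    exact mul_le_one₀ hx.2 (abs_nonneg _) (Real.abs_sin_le_one _)
  have h2 : |Real.cos (n * x) / n ^ 2| ≤ 1 / n := by
    rw [abs_div, abs_of_pos (by positivity : 0 < n ^ 2)]
    gcongr
    · exact Real.abs_cos_le_one _
    · nlinarith
  calc _ ≤ (1 / n + 1 / n) / ν := by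
        gcongr
        exact (abs_add_le _ _).trans (add_le_add h1 h2)
    _ = _ := by ring

/-- The weakly vanishing part `M(x) x cos (n x) / ν` of the gradient of the density. -/
noncomputable def oscPart (ν n x : ℝ) : ℝ :=
  density ν (fun _ => 0) x * x / ν * Real.cos (n * x)

theorem continuous_density_zero_potential (ν : ℝ) : Continuous (density ν (fun _ => 0)) := by
  rw [funext (density_zero_potential ν)]
  fun_prop

theorem memLp_oscPart (ν n : ℝ) : MemLp (oscPart ν n) 2 (volume.restrict Omega) := by
  have := continuous_density_zero_potential ν
  refine memLp_of_continuousOn (Continuous.continuousOn ?_) 2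
  unfold oscPart
  fun_prop

theorem tendsto_inner_oscPart (ν : ℝ) (v : L2 Omega) {s : ℕ → ℝ} (hs : Tendsto s atTop atTop) :
    Tendsto (fun j => inner ℝ v (memLp_oscPart ν (s j)).toLp) atTop (𝓝 0) := by
  have hc := continuous_density_zero_potential ν
  have := tendsto_integral_mul_cos (integrable_mul_of_memLp (Lp.memLp v)
    (memLp_of_continuousOn (by fun_prop : ContinuousOn
      (fun x => density ν (fun _ => 0) x * x / ν) (Icc 0 1)) 2)) hs
  refine this.congr fun j => ?_
  rw [real_inner_comm, inner_toLp]
  refine integral_congr_ae (Eventually.of_forall fun x => ?_)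
  simp only [oscPart]
  ring

/-- By `cos² = (1 + cos 2·) / 2`, the squared norm is `∫ f` plus a Riemann–Lebesgue term. -/
theorem exists_tendsto_norm_oscPart {ν : ℝ} (hν : 0 < ν) {s : ℕ → ℝ}
    (hs : Tendsto s atTop atTop) :
    ∃ c : ℝ, 0 < c ∧ Tendsto (fun j => ‖(memLp_oscPart ν (s j)).toLp‖) atTop (𝓝 c) := by
  have hc := continuous_density_zero_potential ν
  set f : ℝ → ℝ := fun x => (density ν (fun _ => 0) x * x / ν) ^ 2 / 2 with hf
  have hfc : Continuous f := by fun_prop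
  have hfi : Integrable f (volume.restrict Omega) :=
    integrable_of_memLp_two (memLp_of_continuousOn hfc.continuousOn 2)
  have hpos : 0 < ∫ x in Omega, f x := by
    rw [setIntegral_Omega]
    refine intervalIntegral.intervalIntegral_pos_of_pos_on (hfc.intervalIntegrable _ _)
      (fun x hx => ?_) zero_lt_one
    have h1 : 0 < x := hx.1
    have h2 : 0 < 1 - x := by linarith [hx.2]
    rw [hf]
    simp only [density_zero_potential]
    positivity
  refine ⟨√(∫ x in Omega, f x), Real.sqrt_pos.2 hpos, ?_⟩
  have h1 := (tendsto_integral_mul_cos hfi (hs.const_mul_atTop (zero_lt_two' ℝ))).const_add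
    (∫ x in Omega, f x)
  rw [add_zero] at h1
  refine h1.sqrt.congr fun j => ?_
  rw [← Real.sqrt_sq (norm_nonneg (memLp_oscPart ν (s j)).toLp), ← real_inner_self_eq_norm_sq,
    inner_toLp]
  congr 1
  have h2 : ∫ x in Omega, oscPart ν (s j) x * ((memLp_oscPart ν (s j)).toLp : L2 Omega) x
      = ∫ x in Omega, oscPart ν (s j) x * oscPart ν (s j) x := integral_congr_ae (by
    filter_upwards [(memLp_oscPart ν (s j)).coeFn_toLp] with x hx
    rw [hx])
  have hfi2 : Integrable (fun x => f x * Real.cos (2 * s j * x)) (volume.restrict Omega) :=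
    integrable_of_memLp_two (memLp_of_continuousOn (by fun_prop) 2)
  rw [h2, ← integral_add hfi hfi2]
  refine integral_congr_ae (Eventually.of_forall fun x => ?_)
  simp only [oscPart, hf]
  rw [mul_assoc 2, Real.cos_two_mul]
  ring

/-- The densities driven by the oscillating drifts differ from the limit density by the
oscillating parts of their gradients, up to a strongly vanishing term. -/
theorem tendsto_norm_sub_oscPart {ν : ℝ} (hν : 0 < ν) {m : H10 Omega} {mseq : ℕ → H10 Omega}
    {s : ℕ → ℝ} (hs1 : ∀ j, 1 ≤ s j) (hs : Tendsto s atTop atTop)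
    (hm1 : ∀ᵐ x ∂volume.restrict Omega, m.fn x = density ν (fun _ => 0) x)
    (hm2 : ∀ᵐ x ∂volume.restrict Omega, m.grad x = (1 / 2 - x) / ν)
    (hj1 : ∀ j, ∀ᵐ x ∂volume.restrict Omega,
      (mseq j).fn x = density ν (oscPotential ν (s j)) x)
    (hj2 : ∀ j, ∀ᵐ x ∂volume.restrict Omega, (mseq j).grad x =
      (fluxConst (oscPotential ν (s j)) - x
        - oscDrift (s j) x * density ν (oscPotential ν (s j)) x) / ν) :
    Tendsto (fun j => ‖((mseq j - m : H10 Omega) : L2Pair Omega)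
      - WithLp.toLp 2 (0, (memLp_oscPart ν (s j)).toLp)‖) atTop (𝓝 0) := by
  have hs0 : ∀ j, s j ≠ 0 := fun j => (zero_lt_one.trans_le (hs1 j)).ne'
  have hBc : ∀ j, Continuous (oscPotential ν (s j)) := fun j => continuous_oscPotential ν (hs0 j)
  have hBK : ∀ j, ∀ x ∈ Icc (0 : ℝ) 1, |oscPotential ν (s j) x| ≤ 2 / ν := fun j x hx =>
    (abs_oscPotential_le hν (hs1 j) hx).trans (mul_le_of_le_one_right (by positivity)
      ((div_le_one (by linarith [hs1 j])).2 (hs1 j)))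
  have hBlim : ∀ x ∈ Icc (0 : ℝ) 1,
      Tendsto (fun j => oscPotential ν (s j) x) atTop (𝓝 0) := fun x hx => by
    refine squeeze_zero_norm (fun j => abs_oscPotential_le hν (hs1 j) hx) ?_
    simpa using (hs.inv_tendsto_atTop).const_mul (2 / ν)
  set D : ℝ := Real.exp (2 / ν) / ν * Real.exp (2 / ν) with hD
  have hD0 : ∀ x ∈ Icc (0 : ℝ) 1, |density ν (fun _ => 0) x| ≤ D := fun x hx =>
    abs_density_le hν continuous_const (fun _ _ => by rw [abs_zero]; positivity) hx
  have hdiff : ∀ j, ∀ x ∈ Icc (0 : ℝ) 1,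
      |density ν (oscPotential ν (s j)) x - density ν (fun _ => 0) x| ≤ D + D := fun j x hx =>
    (abs_sub _ _).trans (add_le_add (abs_density_le hν (hBc j) (hBK j) hx) (hD0 x hx))
  have hdlim : ∀ x ∈ Icc (0 : ℝ) 1, Tendsto (fun j => density ν (oscPotential ν (s j)) x
      - density ν (fun _ => 0) x) atTop (𝓝 0) := fun x hx => by
    simpa using (tendsto_density hBc hBK hBlim ν hx).sub_const (density ν (fun _ => 0) x)
  have h1 : Tendsto (fun j => ‖(mseq j).fn - m.fn‖) atTop (𝓝 0) := by
    refine tendsto_norm_zero_of_bounded (f := fun j x =>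
      density ν (oscPotential ν (s j)) x - density ν (fun _ => 0) x) (fun j => ?_) hdiff hdlim
    filter_upwards [hm1, hj1 j, Lp.coeFn_sub (mseq j).fn m.fn] with x e1 e2 e3
    rw [e3, Pi.sub_apply, e1, e2]
  have h2 : Tendsto (fun j => ‖(mseq j).grad - m.grad - (memLp_oscPart ν (s j)).toLp‖)
      atTop (𝓝 0) := by
    -- After `oscPart` is removed, the bounded drift multiplies only the difference of the
    -- densities, which tends to zero.
    refine tendsto_norm_zero_of_bounded (K := (1 + (D + D)) / ν) (f := fun j x =>
      (fluxConst (oscPotential ν (s j)) - 1 / 2 - oscDrift (s j) x *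
        (density ν (oscPotential ν (s j)) x - density ν (fun _ => 0) x)) / ν)
      (fun j => ?_) (fun j x hx => ?_) (fun x hx => ?_)
    · filter_upwards [hm2, hj2 j, Lp.coeFn_sub (mseq j).grad m.grad,
        Lp.coeFn_sub ((mseq j).grad - m.grad) (memLp_oscPart ν (s j)).toLp,
        (memLp_oscPart ν (s j)).coeFn_toLp] with x e1 e2 e3 e4 e5
      rw [e4, Pi.sub_apply, e3, Pi.sub_apply, e1, e2, e5, oscPart, oscDrift]
      field_simp
      ring
    · rw [abs_div, abs_of_pos hν]
      have hC := fluxConst_mem_Icc (hBc j)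
      gcongr
      refine (abs_sub _ _).trans (add_le_add
        (abs_le.2 ⟨by linarith [hC.1], by linarith [hC.2]⟩) ?_)
      rw [abs_mul]
      exact (mul_le_of_le_one_left (abs_nonneg _) (abs_oscDrift_le _ hx)).trans (hdiff j x hx)
    · have t1 := (tendsto_fluxConst hBc hBK hBlim).sub_const (1 / 2)
      have t2 : Tendsto (fun j => oscDrift (s j) x * (density ν (oscPotential ν (s j)) x
          - density ν (fun _ => 0) x)) atTop (𝓝 0) := by
        refine squeeze_zero_norm (fun j => ?_) (by simpa using (hdlim x hx).norm)
        rw [norm_mul]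
        exact mul_le_of_le_one_left (norm_nonneg _) (abs_oscDrift_le _ hx)
      simpa using (t1.sub t2).div_const ν
  have h3 : ∀ j, ‖((mseq j - m : H10 Omega) : L2Pair Omega)
      - WithLp.toLp 2 (0, (memLp_oscPart ν (s j)).toLp)‖
      = √(‖(mseq j).fn - m.fn‖ ^ 2
        + ‖(mseq j).grad - m.grad - (memLp_oscPart ν (s j)).toLp‖ ^ 2) := fun j => by
    rw [← Real.sqrt_sq (norm_nonneg (((mseq j - m : H10 Omega) : L2Pair Omega)
      - WithLp.toLp 2 (0, (memLp_oscPart ν (s j)).toLp))), WithLp.prod_norm_sq_eq_of_L2]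
    congr 3
    simp [H10.fn]
  simp only [h3]
  simpa using ((h1.pow 2).add (h2.pow 2)).sqrt

/-! ### The two mean field game systems -/

theorem oneSource_apply (φ : H10 Omega) : oneSource φ = ∫ x in Omega, φ.fn x := by
  have : oneSource φ = inner ℝ ((memLp_const 1).toLp : L2 Omega) φ.fn := rfl
  rw [this, inner_toLp]
  simp

theorem H10_grad_zero_ae : ∀ᵐ x ∂volume.restrict Omega, (0 : H10 Omega).grad x = 0 :=
  Lp.coeFn_zero ℝ 2 (volume.restrict Omega)

/-- For the shifted Huber regularization, the mean field game system with zero coupling and unit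
source decouples: its value function vanishes. -/
theorem isPDESolution_shiftedHuber_iff {ν l : ℝ} (hν : 0 < ν) (hl : 0 < l) (u m : H10 Omega) :
    IsPDESolution ν (shiftedHuber l) zeroCoupling oneSource u m ↔
      u = 0 ∧ ∀ φ : H10 Omega,
        ∫ x in Omega, (ν * m.grad x * φ.grad x + m.fn x * oscDrift (1 / l) x * φ.grad x)
          = ∫ x in Omega, φ.fn x := by
  have hdrift : ∀ φ : H10 Omega, ∫ x in Omega, (ν * m.grad x * φ.grad x
      + m.fn x * deriv (shiftedHuber l x) ((0 : H10 Omega).grad x) * φ.grad x)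
      = ∫ x in Omega, (ν * m.grad x * φ.grad x + m.fn x * oscDrift (1 / l) x * φ.grad x) := by
    intro φ
    refine integral_congr_ae ?_
    filter_upwards [H10_grad_zero_ae, ae_restrict_mem measurableSet_Omega] with x h1 h2
    rw [h1, (hasDerivAt_shiftedHuber hl h2.1.le 0).deriv, huberSlope_shift hl h2.1.le, oscDrift,
      one_div_mul_eq_div]
  constructor
  · rintro ⟨h1, h2⟩
    -- The Lipschitz bound together with the value `0` at `p = 0` dominates the Hamiltonian by the
    -- gradient.
    have hle : ∀ᵐ x ∂volume.restrict Omega, |shiftedHuber l x (u.grad x)| ≤ |u.grad x| :=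
      ae_Omega fun x hx => by
        have := abs_shiftedHuber_sub_le hl hx.1 (u.grad x) 0
        rw [shiftedHuber_zero hl hx.1, sub_zero, sub_zero] at this
        exact this.trans (mul_le_of_le_one_left (abs_nonneg _) hx.2)
    have hk : MemLp (fun x => shiftedHuber l x (u.grad x)) 2 (volume.restrict Omega) :=
      (Lp.memLp u.grad).mono ((continuous_shiftedHuber l).comp_aestronglyMeasurable
        (aestronglyMeasurable_id.prodMk (Lp.aestronglyMeasurable u.grad))) hle
    obtain rfl := eq_zero_of_hamiltonJacobi hν u hk hle h1
    refine ⟨rfl, fun φ => ?_⟩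
    rw [← hdrift, h2 φ, oneSource_apply]
  · rintro ⟨rfl, h⟩
    refine ⟨fun ψ => ?_, fun φ => ?_⟩
    · have : ∫ x in Omega, (ν * (0 : H10 Omega).grad x * ψ.grad x
          + shiftedHuber l x ((0 : H10 Omega).grad x) * ψ.fn x) = ∫ x in Omega, (0 : ℝ) := by
        refine integral_congr_ae ?_
        filter_upwards [H10_grad_zero_ae, ae_restrict_mem measurableSet_Omega] with x h1 h2
        rw [h1, shiftedHuber_zero hl h2.1.le]
        ring
      rw [this, integral_zero]
      rfl
    · rw [hdrift, h φ, oneSource_apply]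

/-- With zero coupling and unit source, `(0, m)` solves the inclusion for `x|p|` when `m` solves
the Poisson equation. -/
theorem isPDISolution_zero {ν : ℝ} {m : H10 Omega}
    (hm : ∀ φ : H10 Omega, ∫ x in Omega, (ν * m.grad x * φ.grad x + m.fn x * 0 * φ.grad x)
      = ∫ x in Omega, φ.fn x) :
    IsPDISolution ν absHamiltonian zeroCoupling oneSource 0 m := by
  have hz := Lp.coeFn_zero ℝ ∞ (volume.restrict Omega)
  -- The selection `b = 0` is allowed because the subdifferential of `x|p|` at `p = 0` is `[-x, x]`.
  refine ⟨0, ?_, fun ψ => ?_, fun φ => ?_⟩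
  · filter_upwards [H10_grad_zero_ae, ae_restrict_mem measurableSet_Omega, hz] with x h1 h2 h3
    intro q
    rw [h1, h3]
    have := mul_nonneg h2.1.le (abs_nonneg q)
    simpa [absHamiltonian] using this
  · have : ∫ x in Omega, (ν * (0 : H10 Omega).grad x * ψ.grad x
        + absHamiltonian x ((0 : H10 Omega).grad x) * ψ.fn x) = ∫ x in Omega, (0 : ℝ) := by
      refine integral_congr_ae ?_
      filter_upwards [H10_grad_zero_ae] with x h1
      simp [h1, absHamiltonian]
    rw [this, integral_zero]
    rfl
  · rw [oneSource_apply, ← hm φ]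
    refine integral_congr_ae ?_
    filter_upwards [hz] with x h1
    rw [h1, Pi.zero_apply]

/-- Completeness makes the Riesz representation of functionals on `H¹₀` available. -/
instance completeSpace_H10 (Ω : Set ℝ) : CompleteSpace (H10 Ω) :=
  (testPairs Ω).isClosed_topologicalClosure.completeSpace_coe

end MFG

/-! ### The main theorem -/

theorem proposition8p1 (ν : ℝ) (hν : 0 < ν) :
    -- the control representation `H(x,p) = sup_{α ∈ [-1,1]} x α p`
    (∀ x ∈ closure MFG.Omega, ∀ p : ℝ,
      IsLUB ((fun α : ℝ => x * α * p) '' Set.Icc (-1) 1) (MFG.absHamiltonian x p)) ∧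
    ∃ (Hreg : ℝ → ℝ → ℝ → ℝ) (lam : ℕ → ℝ)
      (m : MFG.H10 MFG.Omega) (mseq : ℕ → MFG.H10 MFG.Omega),
      -- an admissible family of regularizations: shifted Moreau–Yosida regularizations
      MFG.IsRegFamily MFG.Omega MFG.absHamiltonian 1 Hreg ∧
      (∀ l ∈ Set.Ioc (0 : ℝ) 1, ∀ x ∈ closure MFG.Omega, ∀ p : ℝ,
        Hreg l x p = MFG.moreauYosida MFG.absHamiltonian l x (p - l * x * Real.cos (x / l))
          - l * x ^ 2 * Real.cos (x / l) ^ 2 / 2) ∧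
      -- the regularization parameters `1, 1/2, 1/3, …`, and the oscillating drift
      (∀ j, lam j = 1 / ((j : ℝ) + 1)) ∧
      (∀ j, lam j ∈ Set.Ioc (0 : ℝ) 1) ∧
      Filter.Tendsto lam Filter.atTop (nhds 0) ∧
      (∀ j, ∀ x ∈ closure MFG.Omega,
        HasDerivAt (Hreg (lam j) x) (-x * Real.cos (((j : ℝ) + 1) * x)) 0) ∧
      -- `(0, mseq j)` is the unique weak solution of the regularized problem
      (∀ j, ∀ u' m' : MFG.H10 MFG.Omega,
        MFG.IsPDESolution ν (Hreg (lam j)) MFG.zeroCoupling MFG.oneSource u' m' ↔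
          u' = 0 ∧ m' = mseq j) ∧
      -- `(0, m)` is a weak solution of the inclusion, with `m = x (1 - x) / (2 ν) ≠ 0`
      MFG.IsPDISolution ν MFG.absHamiltonian MFG.zeroCoupling MFG.oneSource 0 m ∧
      (∀ᵐ x ∂MeasureTheory.volume.restrict MFG.Omega,
        m.fn x = x * (1 - x) / (2 * ν)) ∧
      m ≠ 0 ∧
      -- weak convergence in `H¹₀`
      (∀ ℓ : StrongDual ℝ (MFG.H10 MFG.Omega),
        Filter.Tendsto (fun j => ℓ (mseq j)) Filter.atTop (nhds (ℓ m))) ∧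
      -- the limit of the `H¹`-norms of the differences exists and is positive
      ∃ c : ℝ, 0 < c ∧
        Filter.Tendsto (fun j => ‖mseq j - m‖) Filter.atTop (nhds c) := by
  have hcl : ∀ x ∈ closure MFG.Omega, 0 ≤ x := fun x hx => by
    rw [MFG.closure_Omega] at hx
    exact hx.1
  refine ⟨fun x hx p => MFG.isLUB_absHamiltonian (hcl x hx) p, ?_⟩
  -- Indices start at `0`, so the frequency at index `j` is `j + 1`.
  set s : ℕ → ℝ := fun j => (j : ℝ) + 1 with hs_def
  have hs1 : ∀ j, 1 ≤ s j := fun j => le_add_of_nonneg_left (Nat.cast_nonneg j)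
  have hs0 : ∀ j, 0 < s j := fun j => zero_lt_one.trans_le (hs1 j)
  have hs : Tendsto s atTop atTop :=
    tendsto_atTop_add_const_right _ _ tendsto_natCast_atTop_atTop
  have hB0 : ∀ x : ℝ, HasDerivAt (fun _ : ℝ => (0 : ℝ)) ((fun _ => (0 : ℝ)) x / ν) x := fun x => by
    simpa using hasDerivAt_const x (0 : ℝ)
  obtain ⟨m, hm1, hm2⟩ := MFG.exists_fokkerPlanck_solution hν continuous_const hB0
  have hBj : ∀ j x, HasDerivAt (MFG.oscPotential ν (s j)) (MFG.oscDrift (s j) x / ν) x :=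
    fun j => MFG.hasDerivAt_oscPotential ν (hs0 j).ne'
  choose mseq hj1 hj2 using fun j => MFG.exists_fokkerPlanck_solution hν
    (MFG.continuous_oscDrift (s j)) (hBj j)
  have hdist := MFG.tendsto_norm_sub_oscPart hν hs1 hs hm1
    (hm2.mono fun x hx => by rw [hx, MFG.fluxConst_zero]; ring) hj1 hj2
  have hmfn : ∀ᵐ x ∂volume.restrict MFG.Omega, m.fn x = x * (1 - x) / (2 * ν) :=
    hm1.mono fun x hx => hx.trans (MFG.density_zero_potential ν x)
  have hlam : ∀ j, 1 / s j ∈ Ioc (0 : ℝ) 1 := fun j =>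
    ⟨one_div_pos.2 (hs0 j), (div_le_one (hs0 j)).2 (hs1 j)⟩
  refine ⟨MFG.shiftedHuber, fun j => 1 / s j, m, mseq, MFG.isRegFamily_shiftedHuber,
    fun l hl x hx p => ?_, fun j => rfl, hlam, ?_, fun j x hx => ?_, fun j u' m' => ?_, ?_, hmfn,
    ?_, fun ℓ => ?_, ?_⟩
  · rw [MFG.moreauYosida_absHamiltonian hl.1 (hcl x hx), MFG.shiftedHuber]
  · simp only [one_div]
    exact hs.inv_tendsto_atTop
  · have := MFG.hasDerivAt_shiftedHuber (hlam j).1 (hcl x hx) 0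
    rw [MFG.huberSlope_shift (hlam j).1 (hcl x hx), div_div_eq_mul_div, div_one,
      mul_comm x (s j)] at this
    exact this
  · rw [MFG.isPDESolution_shiftedHuber_iff hν (hlam j).1, one_div_one_div,
      MFG.fokkerPlanck_iff hν (MFG.continuous_oscDrift (s j)) (hBj j) (hj1 j) (hj2 j)]
  · exact MFG.isPDISolution_zero
      ((MFG.fokkerPlanck_iff hν continuous_const hB0 hm1 hm2 m).2 rfl)
  · rintro rfl
    have h0 : ∀ᵐ x ∂volume.restrict MFG.Omega, False := by
      filter_upwards [hmfn, Lp.coeFn_zero ℝ 2 (volume.restrict MFG.Omega),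
        ae_restrict_mem MFG.measurableSet_Omega] with x h1 h2 h3
      have h4 : x * (1 - x) / (2 * ν) = 0 := h1.symm.trans h2
      have h5 : 0 < x := h3.1
      have h6 : 0 < 1 - x := by linarith [h3.2]
      have : 0 < x * (1 - x) / (2 * ν) := by positivity
      linarith
    rw [eventually_false_iff_eq_bot, ae_eq_bot, Measure.restrict_eq_zero, MFG.Omega,
      Real.volume_Ioo] at h0
    norm_num at h0
  -- With the Riesz representative `v`, `ℓ (mseq j - m)` splits into a remainder controlled by
  -- `hdist` and the pairing of `v.snd` with `oscPart`.
  · set v := (InnerProductSpace.toDual ℝ (MFG.H10 MFG.Omega)).symm ℓ with hv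
    have hℓ : ∀ y, ℓ y = inner ℝ (v : MFG.L2Pair MFG.Omega) (y : MFG.L2Pair MFG.Omega) := fun y => by
      rw [← Submodule.coe_inner, hv, InnerProductSpace.toDual_symm_apply]
    have h1 := MFG.tendsto_inner_oscPart ν (v : MFG.L2Pair MFG.Omega).snd hs
    have h2 : Tendsto (fun j => inner ℝ (v : MFG.L2Pair MFG.Omega)
        (((mseq j - m : MFG.H10 MFG.Omega) : MFG.L2Pair MFG.Omega)
          - WithLp.toLp 2 (0, (MFG.memLp_oscPart ν (s j)).toLp))) atTop (nhds 0) := by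
      refine squeeze_zero_norm (fun j => norm_inner_le_norm _ _) ?_
      simpa using hdist.const_mul ‖(v : MFG.L2Pair MFG.Omega)‖
    have h3 := (h2.add h1).add_const (ℓ m)
    rw [add_zero, zero_add] at h3
    refine h3.congr fun j => ?_
    rw [inner_sub_right, ← hℓ, map_sub, WithLp.prod_inner_apply]
    simp
  · obtain ⟨c, hc, hlim⟩ := MFG.exists_tendsto_norm_oscPart hν hs
    refine ⟨c, hc, ?_⟩
    have h1 : ∀ j, ‖(WithLp.toLp 2 (0, (MFG.memLp_oscPart ν (s j)).toLp) :
        MFG.L2Pair MFG.Omega)‖ = ‖(MFG.memLp_oscPart ν (s j)).toLp‖ := fun j =>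
      WithLp.norm_toLp_snd ..
    -- By the reverse triangle inequality, the norm has the same limit as that of `oscPart`.
    have h2 : Tendsto (fun j => ‖((mseq j - m : MFG.H10 MFG.Omega) : MFG.L2Pair MFG.Omega)‖
        - ‖(MFG.memLp_oscPart ν (s j)).toLp‖) atTop (nhds 0) := by
      refine squeeze_zero_norm (fun j => ?_) hdist
      rw [← h1]
      exact abs_norm_sub_norm_le _ _
    have h3 := h2.add hlim
    simp only [sub_add_cancel, zero_add] at h3
    exact h3
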